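/- Let $H^3_1=\{(z^1,z^2)\in\mathbb C^2 : |z^1|^2-|z^2|^2=1\}$, identified with $SU(1,1)$ by $(z^1,z^2)\mapsto\begin{pmatrix} z^1&z^2\\ \bar z^2&\bar z^1\end{pmatrix}$. Let $X_0,X_1,X_2$ be the left-invariant vector fields given by $$X_0=\begin{pmatrix} i&0\\0&-i\end{pmatrix},\quad X_1=\begin{pmatrix}0&1\\1&0\end{pmatrix},\quad X_2=\begin{pmatrix}0&i\\-i&0\end{pmatrix}\in\mathfrak{su}(1,1),$$ let $\theta^0,\theta^1,\theta^2$ be the dual one-forms, and put $\alpha\wedge\beta=\alpha\otimes\beta-\beta\otimes\alpha$. Let $\lambda\neq0$, $\mu,\nu>0$ be real with $-\lambda\neq\mu=\nu$, and let $t\in\mathbb R$. Consider the pseudo-Riemannian metric $g=g_{\lambda\mu\nu}=\lambda\,\theta^0\otimes\theta^0+\mu\,\theta^1\otimes\theta^1+\nu\,\theta^2\otimes\theta^2$ with Levi-Civita connection $\nabla$ and curvature $R(X,Y)Z=\nabla_X\nabla_YZ-\nabla_Y\nabla_XZ-\nabla_{[X,Y]}Z$, the $(1,2)$-tensor field $S=S_\lambda(t)$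 determined by $$g(S_XY,Z)=\bigl(-\lambda\,\theta^2\otimes\theta^0\wedge\theta^1+t\,\theta^0\otimes\theta^1\wedge\theta^2-\lambda\,\theta^1\otimes\theta^2\wedge\theta^0\bigr)(X,Y,Z),$$ the connection $\widetilde\nabla=\nabla-S$ with curvature $\widetilde R$, and $$\phi_0=\bar X_1\otimes\bar\theta^2-\bar X_2\otimes\bar\theta^1,\qquad \xi_0=\bar X_0,\qquad \eta_0=\bar\theta^0,$$ where $\bar X_0=X_0/\sqrt{|\lambda|}$, $\bar X_1=X_1/\sqrt\mu$, $\bar X_2=X_2/\sqrt\nu$ and $\bar\theta^\alpha$ is the dual coframe. Let $o=(1,0)$. 1. $(S_\lambda(t),\phi_0,\xi_0,\eta_0)$ is a homogeneous almost contact metric structure on $(H^3_1,g)$. That is, with $\varepsilon=g(\xi_0,\xi_0)=\pm1$ one has $\phi_0^2=-\mathrm{id}+\eta_0\otimes\xi_0$, $\eta_0(\xi_0)=1$, $g(\phi_0X,\phi_0Y)=g(X,Y)-\varepsilon\eta_0(X)\eta_0(Y)$; moreover $\widetilde\nabla g=0$, $\widetilde\nabla R=0$, $\widetilde\nabla S=0$,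 and $\widetilde\nabla\phi_0=0$, $\widetilde\nabla\xi_0=0$, $\widetilde\nabla\eta_0=0$. 2. $(H^3_1,g,\phi_0,\xi_0,\eta_0)$ is $\alpha$-Sasakian with $\alpha=\sqrt{|\lambda|}/\mu$, i.e. $(\nabla_X\phi_0)Y=\alpha\,(g(X,Y)\xi_0-\varepsilon\,\eta_0(Y)X)$. 3. If $t\neq\lambda+2\mu$, then $SU(1,1)\times U(1)$ acts on $(H^3_1,g)$ transitively, almost effectively (the subgroup acting trivially is discrete) and by isometries through $$((A,e^{is}),Z)\mapsto A\,Z\begin{pmatrix}e^{-is}&0\\0&e^{is}\end{pmatrix}.$$ Through the surjective homomorphism $(A,e^{is})\mapsto e^{-is}A$ onto $U(1,1)$ this action induces the transitive, effective and isometric action $(B,Z)\mapsto BZ\,\mathrm{diag}(1,\det(B)^{-1})$ of $U(1,1)$, and the reductive decomposition $\mathfrak u(1,1)=\mathfrak h\oplus\mathfrak m$ at $o$ induced by $S_\lambda(t)$ is $$\mathfrak h=\mathrm{span}_{\mathbb R}\left\{\begin{pmatrix}0&0\\0&i\end{pmatrix}\right\},\qquad \mathfrak m=\mathrm{span}_{\mathbb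 R}\left\{\begin{pmatrix} i&0\\0&\bigl(1+\frac{\lambda-t}{\mu}\bigr)i\end{pmatrix},\ X_1,\ X_2\right\}.$$ 4. If $t=\lambda+2\mu$, then $SU(1,1)$ acts on $(H^3_1,g)$ transitively, effectively and isometrically by left multiplication, and the reductive decomposition at $o$ induced by $S_\lambda(t)$ is the trivial one, $\mathfrak h=0$, $\mathfrak m=\mathfrak{su}(1,1)$. Here "$\mathfrak g=\mathfrak h\oplus\mathfrak m$ is the reductive decomposition at $o$ induced by $S$", for a Lie group $G$ acting on $H^3_1$ with Lie algebra $\mathfrak g$, means the following. The Lie algebra of the isotropy group $H$ of $o$ is $\mathfrak h$, and $\mathfrak m$ is an $\mathrm{Ad}(H)$-invariant complement. The connection $\widetilde\nabla$ is the canonical connection of the decomposition: it is $G$-invariant and $\widetilde\nabla_{X^*}Y^*|_o=-([X,Y]_{\mathfrak m})^*|_o$ for $X,Y\in\mathfrak m$, where $X^*|_p=\frac{d}{ds}\big|_{0}\exp(sX)p$. Finally, the map $X\mapsto X^*|_o$ on $\mathfrak m$ together with some linear isomorphism from $\mathfrak h$ to the span $\widetilde{\mathfrak h}$ of all $\widetilde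 R(X,Y)$ with $X,Y\in T_oH^3_1$ is an isomorphism of Lie algebras from $\mathfrak g$ to $\widetilde{\mathfrak h}\oplus T_oH^3_1$ with the bracket $[U,V]=UV-VU$, $[U,X]=U(X)$, $[X,Y]=S_XY-S_YX-\widetilde R(X,Y)$. -/

import Mathlib

open scoped ContDiff Matrix

noncomputable section

namespace AdS

/-! ### The hypersurface `H³₁ ⊂ ℂ² = ℝ^{2,2}` and its calculus -/

/-- The quadratic form `|z¹|² - |z²|²` on `ℂ²`. -/
def quad (z : ℂ × ℂ) : ℝ := Complex.normSq z.1 - Complex.normSq z.2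

/-- The anti-de Sitter space `H³₁ = {(z¹, z²) ∈ ℂ² : |z¹|² - |z²|² = 1}`. -/
abbrev H31 : Type := {z : ℂ × ℂ // quad z = 1}

/-- The tangent space of the hypersurface `H³₁` at `p`: the kernel of the differential at `p` of
its defining function. -/
def tangent (p : H31) : Submodule ℝ (ℂ × ℂ) :=
  LinearMap.ker (fderiv ℝ quad (p : ℂ × ℂ)).toLinearMap

/-- Half of the differential of `quad` at `z`, applied to `v`. -/
def polar (z v : ℂ × ℂ) : ℝ :=
  z.1.re * v.1.re + z.1.im * v.1.im - (z.2.re * v.2.re + z.2.im * v.2.im)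

theorem contDiff_re {E : Type*} [NormedAddCommGroup E] [NormedSpace ℝ E] {f : E → ℂ}
    (hf : ContDiff ℝ ∞ f) : ContDiff ℝ ∞ (fun x => (f x).re) :=
  Complex.reCLM.contDiff.comp hf

theorem contDiff_im {E : Type*} [NormedAddCommGroup E] [NormedSpace ℝ E] {f : E → ℂ}
    (hf : ContDiff ℝ ∞ f) : ContDiff ℝ ∞ (fun x => (f x).im) :=
  Complex.imCLM.contDiff.comp hf

theorem contDiff_conj {E : Type*} [NormedAddCommGroup E] [NormedSpace ℝ E] {f : E → ℂ}
    (hf : ContDiff ℝ ∞ f) : ContDiff ℝ ∞ (fun x => starRingEnd ℂ (f x)) :=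
  Complex.conjCLE.contDiff.comp hf

theorem contDiff_polar {E : Type*} [NormedAddCommGroup E] [NormedSpace ℝ E] {f h : E → ℂ × ℂ}
    (hf : ContDiff ℝ ∞ f) (hh : ContDiff ℝ ∞ h) : ContDiff ℝ ∞ (fun x => polar (f x) (h x)) := by
  have a1 := contDiff_re hf.fst
  have a2 := contDiff_im hf.fst
  have a3 := contDiff_re hf.snd
  have a4 := contDiff_im hf.snd
  have b1 := contDiff_re hh.fst
  have b2 := contDiff_im hh.fst
  have b3 := contDiff_re hh.snd
  have b4 := contDiff_im hh.snd
  unfold polar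
  exact ((a1.mul b1).add (a2.mul b2)).sub ((a3.mul b3).add (a4.mul b4))

theorem quad_eq_polar (z : ℂ × ℂ) : quad z = polar z z := by
  simp [quad, polar, Complex.normSq_apply]

theorem contDiff_quad : ContDiff ℝ ∞ quad := by
  have : quad = fun z => polar z z := funext quad_eq_polar
  rw [this]
  exact contDiff_polar contDiff_id contDiff_id

theorem quad_add_smul (z v : ℂ × ℂ) (s : ℝ) :
    quad (z + s • v) = quad z + s * (2 * polar z v) + s ^ 2 * quad v := by
  simp [quad, polar, Complex.normSq_apply]
  ring

theorem fderiv_quad (z v : ℂ × ℂ) : fderiv ℝ quad z v = 2 * polar z v := by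
  have hd : HasFDerivAt quad (fderiv ℝ quad z) (z + (0 : ℝ) • v) := by
    simpa using (contDiff_quad.differentiable (by simp) z).hasFDerivAt
  have hl : HasDerivAt (fun s : ℝ => z + s • v) v 0 := by
    simpa using ((hasDerivAt_id (0 : ℝ)).smul_const v).const_add z
  have h1 : HasDerivAt (fun s : ℝ => quad (z + s • v)) (fderiv ℝ quad z v) 0 :=
    HasFDerivAt.comp_hasDerivAt (f := fun s : ℝ => z + s • v) (0 : ℝ) hd hl
  have h2 : HasDerivAt (fun s : ℝ => quad (z + s • v)) (2 * polar z v) 0 := by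
    simp only [quad_add_smul]
    have e1 := (((hasDerivAt_id (0 : ℝ)).mul_const (2 * polar z v)).const_add (quad z))
    have e2 := ((hasDerivAt_pow 2 (0 : ℝ)).mul_const (quad v))
    simpa using e1.fun_add e2
  exact h1.unique h2

theorem mem_tangent {p : H31} {v : ℂ × ℂ} : v ∈ tangent p ↔ polar p v = 0 := by
  simp [tangent, fderiv_quad]

/-- A differentiable function that vanishes on `H³₁` has vanishing derivative in the tangent
directions; hence tangential derivatives can be computed with any extension. -/
theorem fderiv_eq_zero_of_vanish {F : Type*} [NormedAddCommGroup F] [NormedSpace ℝ F]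
    {f : ℂ × ℂ → F} (hf : Differentiable ℝ f) (h0 : ∀ p : H31, f p = 0) (p : H31) {v : ℂ × ℂ}
    (hv : v ∈ tangent p) : fderiv ℝ f p v = 0 := by
  have hq : ∀ s : ℝ, quad ((p : ℂ × ℂ) + s • v) = 1 + s ^ 2 * quad v := by
    intro s
    rw [quad_add_smul, mem_tangent.1 hv, p.2]
    ring
  have hr : HasDerivAt (fun s : ℝ => (Real.sqrt (1 + s ^ 2 * quad v))⁻¹) 0 0 := by
    have e2 : HasDerivAt (fun s : ℝ => 1 + s ^ 2 * quad v) 0 0 := by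
      simpa using ((hasDerivAt_pow 2 (0 : ℝ)).mul_const (quad v)).const_add 1
    have e3 := (e2.sqrt (by simp)).fun_inv (by simp)
    simpa using e3
  have hl : HasDerivAt (fun s : ℝ => (p : ℂ × ℂ) + s • v) v 0 := by
    simpa using ((hasDerivAt_id (0 : ℝ)).smul_const v).const_add (p : ℂ × ℂ)
  have hg : HasDerivAt (fun s : ℝ => (Real.sqrt (1 + s ^ 2 * quad v))⁻¹ •
      ((p : ℂ × ℂ) + s • v)) v 0 := by
    simpa using hr.fun_smul hl
  have hfd : HasFDerivAt f (fderiv ℝ f p)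
      ((Real.sqrt (1 + (0 : ℝ) ^ 2 * quad v))⁻¹ • ((p : ℂ × ℂ) + (0 : ℝ) • v)) := by
    simpa using (hf p).hasFDerivAt
  have hc := hfd.comp_hasDerivAt (0 : ℝ) hg
  have hpos : ∀ᶠ s : ℝ in nhds 0, 0 < 1 + s ^ 2 * quad v := by
    have : Continuous (fun s : ℝ => 1 + s ^ 2 * quad v) := by fun_prop
    exact this.continuousAt.eventually (lt_mem_nhds (by simp))
  have hz : (f ∘ fun s : ℝ => (Real.sqrt (1 + s ^ 2 * quad v))⁻¹ • ((p : ℂ × ℂ) + s • v))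
      =ᶠ[nhds 0] fun _ => (0 : F) := by
    filter_upwards [hpos] with s hs
    have hsm : ∀ (c : ℝ) (w : ℂ × ℂ), quad (c • w) = c ^ 2 * quad w := by
      intro c w
      simp [quad, Complex.normSq_apply]
      ring
    refine h0 ⟨_, ?_⟩
    rw [hsm, hq, inv_pow, Real.sq_sqrt hs.le, inv_mul_cancel₀ hs.ne']
  exact (hc.congr_of_eventuallyEq hz.symm).unique (hasDerivAt_const _ _)

/-- Smoothness of a map on the closed hypersurface `H³₁`: it is the restriction of a smooth map
on `ℂ²`. -/
def IsSmooth {F : Type*} [NormedAddCommGroup F] [NormedSpace ℝ F] (f : H31 → F) : Prop :=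
  ∃ f' : ℂ × ℂ → F, ContDiff ℝ ∞ f' ∧ ∀ p : H31, f p = f' p

section Ext

variable {F : Type*} [NormedAddCommGroup F] [NormedSpace ℝ F] {f : H31 → F}

/-- Some smooth extension of a smooth map on `H³₁`. -/
def IsSmooth.ext (hf : IsSmooth f) : ℂ × ℂ → F := hf.choose

theorem IsSmooth.contDiff_ext (hf : IsSmooth f) : ContDiff ℝ ∞ hf.ext := hf.choose_spec.1

theorem IsSmooth.ext_apply (hf : IsSmooth f) (p : H31) : hf.ext p = f p :=
  (hf.choose_spec.2 p).symm

/-- The derivative of a smooth map `f` on `H³₁` at `p` in the tangent direction `v`, computed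
through a smooth extension of `f` (on which it does not depend, see `IsSmooth.deriv_eq`). -/
def IsSmooth.deriv (hf : IsSmooth f) (p : H31) (v : ℂ × ℂ) : F := fderiv ℝ hf.ext p v

theorem IsSmooth.deriv_eq (hf : IsSmooth f) {f' : ℂ × ℂ → F} (hf' : ContDiff ℝ ∞ f')
    (h : ∀ p : H31, f p = f' p) (p : H31) {v : ℂ × ℂ} (hv : v ∈ tangent p) :
    hf.deriv p v = fderiv ℝ f' p v := by
  have d1 := hf.contDiff_ext.differentiable (by simp)
  have d2 := hf'.differentiable (by simp)
  have := fderiv_eq_zero_of_vanish (d1.sub d2)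
    (fun q => by simp [hf.ext_apply, h]) p hv
  rw [fderiv_sub (d1 _) (d2 _)] at this
  exact sub_eq_zero.1 this

theorem IsSmooth.contDiff_fderiv_ext (hf : IsSmooth f) {w : ℂ × ℂ → ℂ × ℂ}
    (hw : ContDiff ℝ ∞ w) : ContDiff ℝ ∞ (fun z => fderiv ℝ hf.ext z (w z)) :=
  (hf.contDiff_ext.fderiv_right (m := ∞) (by simp)).clm_apply hw

end Ext

/-- Smooth functions as a subalgebra of all functions. -/
def smoothSubalgebra : Subalgebra ℝ (H31 → ℝ) where
  carrier := {f | IsSmooth f}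
  mul_mem' := by
    rintro f h ⟨f', hf, ef⟩ ⟨h', hh, eh⟩
    exact ⟨fun z => f' z * h' z, hf.mul hh, fun p => by simp [ef, eh]⟩
  add_mem' := by
    rintro f h ⟨f', hf, ef⟩ ⟨h', hh, eh⟩
    exact ⟨fun z => f' z + h' z, hf.add hh, fun p => by simp [ef, eh]⟩
  algebraMap_mem' r := ⟨fun _ => r, contDiff_const, fun _ => rfl⟩

/-- The algebra `C^∞(H³₁)`. -/
def Smooth : Type := smoothSubalgebra

instance : CommRing Smooth := inferInstanceAs (CommRing smoothSubalgebra)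
instance : Algebra ℝ Smooth := inferInstanceAs (Algebra ℝ smoothSubalgebra)
instance : FunLike Smooth H31 ℝ where
  coe f := Subtype.val (p := fun f => f ∈ smoothSubalgebra) f
  coe_injective := Subtype.val_injective

theorem Smooth.isSmooth (f : Smooth) : IsSmooth f :=
  Subtype.property (p := fun f => f ∈ smoothSubalgebra) f

/-- Bundling a smooth function. -/
def Smooth.mk (f : H31 → ℝ) (hf : IsSmooth f) : Smooth :=
  (⟨f, hf⟩ : smoothSubalgebra)

namespace Smooth

@[ext] theorem ext {f h : Smooth} (e : ∀ p, f p = h p) : f = h := DFunLike.ext f h e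
@[simp] theorem mk_apply (f : H31 → ℝ) (hf : IsSmooth f) (p : H31) : Smooth.mk f hf p = f p := rfl
@[simp] theorem add_apply (f h : Smooth) (p : H31) : (f + h) p = f p + h p := rfl
@[simp] theorem sub_apply (f h : Smooth) (p : H31) : (f - h) p = f p - h p := rfl
@[simp] theorem neg_apply (f : Smooth) (p : H31) : (-f) p = -f p := rfl
@[simp] theorem mul_apply (f h : Smooth) (p : H31) : (f * h) p = f p * h p := rfl
@[simp] theorem zero_apply (p : H31) : (0 : Smooth) p = 0 := rfl
@[simp] theorem one_apply (p : H31) : (1 : Smooth) p = 1 := rfl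
@[simp] theorem smul_apply (r : ℝ) (f : Smooth) (p : H31) : (r • f) p = r * f p := rfl
@[simp] theorem algebraMap_apply (r : ℝ) (p : H31) : (algebraMap ℝ Smooth r) p = r := rfl

end Smooth

/-- Smooth tangent vector fields as a `C^∞(H³₁)`-submodule of all maps `H³₁ → ℂ²`. -/
def vfieldSubmodule : Submodule smoothSubalgebra (H31 → ℂ × ℂ) where
  carrier := {V | IsSmooth V ∧ ∀ p, V p ∈ tangent p}
  add_mem' := by
    rintro V W ⟨⟨V', hV, eV⟩, tV⟩ ⟨⟨W', hW, eW⟩, tW⟩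
    exact ⟨⟨fun z => V' z + W' z, hV.add hW, fun p => by simp [eV, eW]⟩,
      fun p => (tangent p).add_mem (tV p) (tW p)⟩
  zero_mem' := ⟨⟨fun _ => 0, contDiff_const, fun _ => rfl⟩, fun p => (tangent p).zero_mem⟩
  smul_mem' := by
    rintro f V ⟨⟨V', hV, eV⟩, tV⟩
    obtain ⟨f', hf, ef⟩ : IsSmooth f.1 := f.2
    refine ⟨⟨fun z => f' z • V' z, hf.smul hV, fun p => ?_⟩,
      fun p => (tangent p).smul_mem (f.1 p) (tV p)⟩
    change f.1 p • V p = f' p • V' p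
    rw [ef, eV]

/-- The `C^∞(H³₁)`-module `Γ(T H³₁)` of smooth vector fields on `H³₁`. -/
def VField : Type := vfieldSubmodule

instance : AddCommGroup VField := inferInstanceAs (AddCommGroup vfieldSubmodule)
instance : Module Smooth VField := inferInstanceAs (Module smoothSubalgebra vfieldSubmodule)
instance : Module ℝ VField := Module.compHom VField (algebraMap ℝ Smooth)
instance : IsScalarTower ℝ Smooth VField := IsScalarTower.of_algebraMap_smul fun _ _ => rfl
instance : SMulCommClass Smooth ℝ VField := IsScalarTower.to_smulCommClass'
instance : FunLike VField H31 (ℂ × ℂ) where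
  coe V := Subtype.val (p := fun V => V ∈ vfieldSubmodule) V
  coe_injective := Subtype.val_injective

namespace VField

theorem isSmooth (V : VField) : IsSmooth V :=
  (Subtype.property (p := fun V => V ∈ vfieldSubmodule) V).1

theorem mem_tangent (V : VField) (p : H31) : V p ∈ tangent p :=
  (Subtype.property (p := fun V => V ∈ vfieldSubmodule) V).2 p

/-- Bundling a smooth tangent vector field. -/
def mk (V : H31 → ℂ × ℂ) (hV : IsSmooth V) (tV : ∀ p, V p ∈ tangent p) : VField :=
  (⟨V, hV, tV⟩ : vfieldSubmodule)

@[ext] theorem ext {V W : VField} (e : ∀ p, V p = W p) : V = W := DFunLike.ext V W e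
@[simp] theorem mk_apply (V : H31 → ℂ × ℂ) (hV : IsSmooth V) (tV : ∀ p, V p ∈ tangent p)
    (p : H31) : VField.mk V hV tV p = V p := rfl
@[simp] theorem add_apply (V W : VField) (p : H31) : (V + W) p = V p + W p := rfl
@[simp] theorem sub_apply (V W : VField) (p : H31) : (V - W) p = V p - W p := rfl
@[simp] theorem neg_apply (V : VField) (p : H31) : (-V) p = -V p := rfl
@[simp] theorem zero_apply (p : H31) : (0 : VField) p = 0 := rfl
@[simp] theorem smul_apply (f : Smooth) (V : VField) (p : H31) : (f • V) p = f p • V p := rfl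
@[simp] theorem real_smul_apply (r : ℝ) (V : VField) (p : H31) : (r • V) p = r • V p := rfl

/-- The value of a vector field at a point, as a tangent vector. -/
def at' (V : VField) (p : H31) : tangent p := ⟨V p, V.mem_tangent p⟩

end VField

/-- The function `X f`. -/
def act (X : VField) (f : Smooth) : Smooth :=
  Smooth.mk (fun p => f.isSmooth.deriv p (X p))
    ⟨fun z => fderiv ℝ f.isSmooth.ext z (X.isSmooth.ext z),
      f.isSmooth.contDiff_fderiv_ext X.isSmooth.contDiff_ext,
      fun p => by simp only [X.isSmooth.ext_apply]; rfl⟩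

theorem act_apply (X : VField) (f : Smooth) (p : H31) : act X f p = f.isSmooth.deriv p (X p) := rfl

/-- The Lie bracket `[X, Y] = dY(X) - dX(Y)` of vector fields. -/
def bracket (X Y : VField) : VField :=
  VField.mk (fun p => Y.isSmooth.deriv p (X p) - X.isSmooth.deriv p (Y p))
    ⟨fun z => fderiv ℝ Y.isSmooth.ext z (X.isSmooth.ext z) -
        fderiv ℝ X.isSmooth.ext z (Y.isSmooth.ext z),
      (Y.isSmooth.contDiff_fderiv_ext X.isSmooth.contDiff_ext).sub
        (X.isSmooth.contDiff_fderiv_ext Y.isSmooth.contDiff_ext),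
      fun p => by simp only [X.isSmooth.ext_apply, Y.isSmooth.ext_apply]; rfl⟩ (by
    intro p
    have key : ∀ V W : VField, polar p (V.isSmooth.deriv p (W p)) =
        - polar (V p) (W p) := by
      intro V W
      have hd : Differentiable ℝ V.isSmooth.ext :=
        V.isSmooth.contDiff_ext.differentiable (by simp)
      have h0 := fderiv_eq_zero_of_vanish
        (f := fun z => polar z (V.isSmooth.ext z))
        ((contDiff_polar contDiff_id V.isSmooth.contDiff_ext).differentiable (by simp))
        (fun q => by rw [V.isSmooth.ext_apply]; exact AdS.mem_tangent.1 (V.mem_tangent q)) p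
        (W.mem_tangent p)
      set w := W p
      have hl : HasDerivAt (fun s : ℝ => (p : ℂ × ℂ) + s • w) w 0 := by
        simpa using ((hasDerivAt_id (0 : ℝ)).smul_const w).const_add (p : ℂ × ℂ)
      have hV : HasDerivAt (fun s : ℝ => V.isSmooth.ext ((p : ℂ × ℂ) + s • w))
          (V.isSmooth.deriv p w) 0 := by
        have : HasFDerivAt V.isSmooth.ext (fderiv ℝ V.isSmooth.ext p)
            ((p : ℂ × ℂ) + (0 : ℝ) • w) := by simpa using (hd p).hasFDerivAt
        exact this.comp_hasDerivAt (0 : ℝ) hl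
      have hP : HasDerivAt (fun s : ℝ => polar ((p : ℂ × ℂ) + s • w)
          (V.isSmooth.ext ((p : ℂ × ℂ) + s • w)))
          (fderiv ℝ (fun z => polar z (V.isSmooth.ext z)) p w) 0 := by
        have : HasFDerivAt (fun z => polar z (V.isSmooth.ext z))
            (fderiv ℝ (fun z => polar z (V.isSmooth.ext z)) p) ((p : ℂ × ℂ) + (0 : ℝ) • w) := by
          simpa using (((contDiff_polar contDiff_id V.isSmooth.contDiff_ext).differentiable
            (by simp)) (p : ℂ × ℂ)).hasFDerivAt
        exact this.comp_hasDerivAt (0 : ℝ) hl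
      have re1 : ∀ {c : ℝ → ℂ} {c' : ℂ}, HasDerivAt c c' 0 →
          HasDerivAt (fun s => (c s).re) c'.re 0 := fun h =>
        Complex.reCLM.hasFDerivAt.comp_hasDerivAt (0 : ℝ) h
      have im1 : ∀ {c : ℝ → ℂ} {c' : ℂ}, HasDerivAt c c' 0 →
          HasDerivAt (fun s => (c s).im) c'.im 0 := fun h =>
        Complex.imCLM.hasFDerivAt.comp_hasDerivAt (0 : ℝ) h
      have hl1 := (ContinuousLinearMap.fst ℝ ℂ ℂ).hasFDerivAt.comp_hasDerivAt (0 : ℝ) hl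
      have hl2 := (ContinuousLinearMap.snd ℝ ℂ ℂ).hasFDerivAt.comp_hasDerivAt (0 : ℝ) hl
      have hV1 := (ContinuousLinearMap.fst ℝ ℂ ℂ).hasFDerivAt.comp_hasDerivAt (0 : ℝ) hV
      have hV2 := (ContinuousLinearMap.snd ℝ ℂ ℂ).hasFDerivAt.comp_hasDerivAt (0 : ℝ) hV
      have hQ := (((re1 hl1).mul (re1 hV1)).add ((im1 hl1).mul (im1 hV1))).sub
        (((re1 hl2).mul (re1 hV2)).add ((im1 hl2).mul (im1 hV2)))
      have hu := hP.unique hQ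
      rw [h0] at hu
      simp only [Function.comp, ContinuousLinearMap.coe_fst', ContinuousLinearMap.coe_snd',
        zero_smul, add_zero, V.isSmooth.ext_apply] at hu
      simp only [polar]
      linarith
    rw [mem_tangent]
    have k1 := key Y X
    have k2 := key X Y
    simp only [polar, Prod.fst_sub, Prod.snd_sub, Complex.sub_re, Complex.sub_im] at k1 k2 ⊢
    linarith)

theorem bracket_apply (X Y : VField) (p : H31) :
    bracket X Y p = Y.isSmooth.deriv p (X p) - X.isSmooth.deriv p (Y p) := rfl

/-! ### The left-invariant frame, the metrics and the tensor fields -/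

/-- The identification `(z¹, z²) ↦ ((z¹, z²), (conj z², conj z¹))` of `H³₁` with `SU(1,1)`. -/
def toMat (z : ℂ × ℂ) : Matrix (Fin 2) (Fin 2) ℂ :=
  !![z.1, z.2; starRingEnd ℂ z.2, starRingEnd ℂ z.1]

/-- The first row of a matrix; this inverts `toMat`. -/
def ofMat (M : Matrix (Fin 2) (Fin 2) ℂ) : ℂ × ℂ := (M 0 0, M 0 1)

/-- The basis `X₀, X₁, X₂` of the Lie algebra `su(1,1)`. -/
def pauli : Fin 3 → Matrix (Fin 2) (Fin 2) ℂ :=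
  ![!![Complex.I, 0; 0, -Complex.I], !![0, 1; 1, 0], !![0, Complex.I; -Complex.I, 0]]

/-- The left-invariant vector fields `X_α` on `H³₁ ≃ SU(1,1)`: the value of `X_α` at the matrix
`Z` is `Z X_α`. -/
def frame (α : Fin 3) : VField :=
  have h : ∀ z : ℂ × ℂ, ofMat (toMat z * pauli 0) = (z.1 * Complex.I, -(z.2 * Complex.I)) ∧
      ofMat (toMat z * pauli 1) = (z.2, z.1) ∧
      ofMat (toMat z * pauli 2) = (-(z.2 * Complex.I), z.1 * Complex.I) := by
    intro z
    simp [ofMat, toMat, pauli]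
  VField.mk (fun p => ofMat (toMat p * pauli α))
    ⟨fun z => ofMat (toMat z * pauli α), by
      have h1 : ContDiff ℝ ∞ (fun z : ℂ × ℂ => z.1) := contDiff_fst
      have h2 : ContDiff ℝ ∞ (fun z : ℂ × ℂ => z.2) := contDiff_snd
      have h1i := h1.mul (contDiff_const (c := Complex.I))
      have h2i := h2.mul (contDiff_const (c := Complex.I))
      fin_cases α
      · simp only [Fin.zero_eta, fun z => (h z).1]
        exact h1i.prodMk h2i.neg
      · simp only [Fin.mk_one, fun z => (h z).2.1]
        exact h2.prodMk h1
      · simp only [Fin.reduceFinMk, fun z => (h z).2.2]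
        exact h2i.neg.prodMk h1i, fun p => rfl⟩
    (fun p => by
      rw [mem_tangent]
      fin_cases α
      · simp only [Fin.zero_eta, (h _).1, polar]
        simp
        ring
      · simp only [Fin.mk_one, (h _).2.1, polar]
        ring
      · simp only [Fin.reduceFinMk, (h _).2.2, polar]
        simp
        ring)

/-- The coframe in coordinates: if `Z` and `V` are the matrices of `z` and `v`, then
`Z⁻¹ V = θ⁰(v) X₀ + θ¹(v) X₁ + θ²(v) X₂` for `v` tangent at `z`
(see `coframe_frame` and `sum_coframe`). -/
def coframeAt (α : Fin 3) (z v : ℂ × ℂ) : ℝ :=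
  ![(starRingEnd ℂ z.1 * v.1 - z.2 * starRingEnd ℂ v.2).im,
    (starRingEnd ℂ z.1 * v.2 - z.2 * starRingEnd ℂ v.1).re,
    (starRingEnd ℂ z.1 * v.2 - z.2 * starRingEnd ℂ v.1).im] α

/-- The left-invariant one-forms `θ^α` dual to the frame `X_α`. -/
def coframe (α : Fin 3) : VField →ₗ[Smooth] Smooth where
  toFun V := Smooth.mk (fun p => coframeAt α p (V p)) (by
    refine ⟨fun z => coframeAt α z (V.isSmooth.ext z), ?_,
      fun p => by simp only [V.isSmooth.ext_apply]⟩
    have h1 : ContDiff ℝ ∞ (fun z : ℂ × ℂ => z.1) := contDiff_fst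
    have h2 : ContDiff ℝ ∞ (fun z : ℂ × ℂ => z.2) := contDiff_snd
    have hV := V.isSmooth.contDiff_ext
    have a := ((contDiff_conj h1).mul hV.fst).sub (h2.mul (contDiff_conj hV.snd))
    have b := ((contDiff_conj h1).mul hV.snd).sub (h2.mul (contDiff_conj hV.fst))
    fin_cases α
    · exact contDiff_im a
    · exact contDiff_re b
    · exact contDiff_im b)
  map_add' V W := by
    ext p
    simp only [Smooth.mk_apply, VField.add_apply, Smooth.add_apply]
    fin_cases α <;> simp [coframeAt] <;> ring
  map_smul' f V := by
    ext p
    simp only [Smooth.mk_apply, VField.smul_apply, RingHom.id_apply, smul_eq_mul,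
      Smooth.mul_apply]
    fin_cases α <;> simp [coframeAt] <;> ring

@[simp] theorem frame_apply (α : Fin 3) (p : H31) : frame α p = ofMat (toMat p * pauli α) := rfl

@[simp] theorem coframe_apply (α : Fin 3) (V : VField) (p : H31) :
    coframe α V p = coframeAt α p (V p) := rfl

theorem coframe_frame (α β : Fin 3) : coframe α (frame β) = if α = β then 1 else 0 := by
  ext p
  have hp : quad p = 1 := p.2
  simp only [quad, Complex.normSq_apply] at hp
  fin_cases α <;> fin_cases β <;> simp [coframeAt, ofMat, toMat, pauli] <;> linarith

theorem sum_coframe (V : VField) : V = ∑ α, coframe α V • frame α := by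
  ext1 p
  have hp : quad p = 1 := p.2
  have hv := AdS.mem_tangent.1 (V.mem_tangent p)
  simp only [quad, Complex.normSq_apply] at hp
  simp only [polar] at hv
  simp only [Fin.sum_univ_three, VField.add_apply, VField.smul_apply, coframe_apply, frame_apply]
  set v := V p
  refine Prod.ext (Complex.ext ?_ ?_) (Complex.ext ?_ ?_) <;>
    simp [coframeAt, ofMat, toMat, pauli]
  · linear_combination (-v.1.re) * hp + (p : ℂ × ℂ).1.re * hv
  · linear_combination (-v.1.im) * hp + (p : ℂ × ℂ).1.im * hv
  · linear_combination (-v.2.re) * hp + (p : ℂ × ℂ).2.re * hv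
  · linear_combination (-v.2.im) * hp + (p : ℂ × ℂ).2.im * hv

/-- The tensor product of a one-form with a tensor: `(α ⊗ T)(X, …) = α(X) T(…)`. -/
def tens {N : Type*} [AddCommGroup N] [Module Smooth N] (α : VField →ₗ[Smooth] Smooth) (T : N) :
    VField →ₗ[Smooth] N :=
  α.smulRight T

/-- The wedge product of one-forms, `α ∧ β = α ⊗ β - β ⊗ α`. -/
def wedge (α β : VField →ₗ[Smooth] Smooth) : VField →ₗ[Smooth] VField →ₗ[Smooth] Smooth :=
  tens α β - tens β α

/-- The metric `λ θ⁰ ⊗ θ⁰ + μ θ¹ ⊗ θ¹ + ν θ² ⊗ θ²` of Kaluza-Klein type. -/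
def metric (lam mu nu : ℝ) : VField →ₗ[Smooth] VField →ₗ[Smooth] Smooth :=
  lam • tens (coframe 0) (coframe 0) + mu • tens (coframe 1) (coframe 1) +
    nu • tens (coframe 2) (coframe 2)

/-- The tensor field
`S_λ(t) = -λ θ² ⊗ (θ⁰ ∧ θ¹) + t θ⁰ ⊗ (θ¹ ∧ θ²) - λ θ¹ ⊗ (θ² ∧ θ⁰)` of type `(0,3)`. -/
def Slam (lam t : ℝ) : VField →ₗ[Smooth] VField →ₗ[Smooth] VField →ₗ[Smooth] Smooth :=
  (-lam) • tens (coframe 2) (wedge (coframe 0) (coframe 1)) +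
    t • tens (coframe 0) (wedge (coframe 1) (coframe 2)) +
    (-lam) • tens (coframe 1) (wedge (coframe 2) (coframe 0))

/-- The orthonormal frame `X₀ / √|λ|, X₁ / √μ, X₂ / √ν`. -/
def onFrame (lam mu nu : ℝ) : Fin 3 → VField :=
  ![(√|lam|)⁻¹ • frame 0, (√mu)⁻¹ • frame 1, (√nu)⁻¹ • frame 2]

/-- The coframe dual to the orthonormal frame. -/
def onCoframe (lam mu nu : ℝ) : Fin 3 → (VField →ₗ[Smooth] Smooth) :=
  ![√|lam| • coframe 0, √mu • coframe 1, √nu • coframe 2]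

/-- `φ₀ = X̄₁ ⊗ θ̄² - X̄₂ ⊗ θ̄¹`. -/
def phi0 (lam mu nu : ℝ) : VField →ₗ[Smooth] VField :=
  tens (onCoframe lam mu nu 2) (onFrame lam mu nu 1) -
    tens (onCoframe lam mu nu 1) (onFrame lam mu nu 2)

/-- The Reeb vector field `ξ₀ = X̄₀`. -/
def xi0 (lam mu nu : ℝ) : VField := onFrame lam mu nu 0

/-- The contact form `η₀ = θ̄⁰`. -/
def eta0 (lam mu nu : ℝ) : VField →ₗ[Smooth] Smooth := onCoframe lam mu nu 0

/-! ### Connections and homogeneous structures on `H³₁`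

Tensor fields are `C^∞(H³₁)`-multilinear maps on `Γ(T H³₁)`. -/

/-- Pseudo-Riemannian metrics: symmetric and nondegenerate at every point. -/
structure IsPseudoRiemannian (g : VField →ₗ[Smooth] VField →ₗ[Smooth] Smooth) : Prop where
  symm : ∀ X Y, g X Y = g Y X
  nondegenerate : ∀ (p : H31) (X : VField),
    (∀ Y, g X Y p = 0) → X p = 0

/-- Linear connections. -/
structure IsConnection (D : VField → VField → VField) : Prop where
  add_left : ∀ X Y Z, D (X + Y) Z = D X Z + D Y Z
  smul_left : ∀ (f : Smooth) X Y, D (f • X) Y = f • D X Y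
  add_right : ∀ X Y Z, D X (Y + Z) = D X Y + D X Z
  leibniz : ∀ (f : Smooth) X Y, D X (f • Y) = act X f • Y + f • D X Y

/-- `∇ g = 0`. -/
def IsMetricConnection (g : VField →ₗ[Smooth] VField →ₗ[Smooth] Smooth)
    (D : VField → VField → VField) : Prop :=
  ∀ X Y Z, act X (g Y Z) = g (D X Y) Z + g Y (D X Z)

/-- `D` is the Levi-Civita connection of `g`. -/
structure IsLeviCivita (g : VField →ₗ[Smooth] VField →ₗ[Smooth] Smooth)
    (D : VField → VField → VField) : Prop where
  connection : IsConnection D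
  torsion_free : ∀ X Y, D X Y - D Y X = bracket X Y
  metric : IsMetricConnection g D

/-- The curvature `R(X,Y)Z = ∇_X ∇_Y Z - ∇_Y ∇_X Z - ∇_{[X,Y]} Z`. -/
def curv (D : VField → VField → VField) (X Y Z : VField) : VField :=
  D X (D Y Z) - D Y (D X Z) - D (bracket X Y) Z

/-- The connection `∇ - S`. -/
def canon (D : VField → VField → VField) (S : VField →ₗ[Smooth] VField →ₗ[Smooth] VField)
    (X Y : VField) : VField :=
  D X Y - S X Y

/-- `S` is a homogeneous pseudo-Riemannian structure for the metric `g` with Levi-Civita connection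
`D`: the connection `∇ - S` makes `g`, the curvature tensor of `g`, and `S` parallel. -/
structure IsHomogeneousStructure (g : VField →ₗ[Smooth] VField →ₗ[Smooth] Smooth)
    (D : VField → VField → VField) (S : VField →ₗ[Smooth] VField →ₗ[Smooth] VField) : Prop where
  metric : IsMetricConnection g (canon D S)
  curvature : ∀ X Y Z W, canon D S X (curv D Y Z W) =
    curv D (canon D S X Y) Z W + curv D Y (canon D S X Z) W + curv D Y Z (canon D S X W)
  tensor : ∀ X Y Z, canon D S X (S Y Z) = S (canon D S X Y) Z + S Y (canon D S X Z)

/-- `(g, φ, ξ, η)` is an almost contact metric structure, where `ε = g(ξ, ξ) = ±1`. -/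
structure IsAlmostContactMetric (g : VField →ₗ[Smooth] VField →ₗ[Smooth] Smooth)
    (φ : VField →ₗ[Smooth] VField) (ξ : VField) (η : VField →ₗ[Smooth] Smooth) : Prop where
  phi_phi : ∀ X, φ (φ X) = -X + η X • ξ
  eta_xi : η ξ = 1
  xi_unit : g ξ ξ = 1 ∨ g ξ ξ = -1
  compatible : ∀ X Y, g (φ X) (φ Y) = g X Y - g ξ ξ * (η X * η Y)

/-- The `α`-Sasakian condition `(∇_X φ) Y = α (g(X, Y) ξ - ε η(Y) X)`, where `ε = g(ξ, ξ)`. -/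
def IsSasakian (g : VField →ₗ[Smooth] VField →ₗ[Smooth] Smooth) (D : VField → VField → VField)
    (φ : VField →ₗ[Smooth] VField) (ξ : VField) (η : VField →ₗ[Smooth] Smooth) (α : Smooth) :
    Prop :=
  ∀ X Y, D X (φ Y) - φ (D X Y) = α • (g X Y • ξ - (g ξ ξ * η Y) • X)

/-- `(S, φ, ξ, η)` is a homogeneous almost contact metric structure: `S` is a homogeneous structure
and the almost contact structure is parallel for `∇ - S`. -/
structure IsHomogeneousAlmostContactMetric (g : VField →ₗ[Smooth] VField →ₗ[Smooth] Smooth)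
    (D : VField → VField → VField) (S : VField →ₗ[Smooth] VField →ₗ[Smooth] VField)
    (φ : VField →ₗ[Smooth] VField) (ξ : VField) (η : VField →ₗ[Smooth] Smooth) : Prop where
  almostContactMetric : IsAlmostContactMetric g φ ξ η
  homogeneous : IsHomogeneousStructure g D S
  phi : ∀ X Y, canon D S X (φ Y) = φ (canon D S X Y)
  xi : ∀ X, canon D S X ξ = 0
  eta : ∀ X Y, act X (η Y) = η (canon D S X Y)

/-! ### The groups `U(1,1)`, `SU(1,1)` and their actions -/

/-- The matrix `diag(1, -1)`. -/
def J : Matrix (Fin 2) (Fin 2) ℂ := !![1, 0; 0, -1]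

/-- The matrix group `U(1,1)`. -/
def U11 : Subgroup (GL (Fin 2) ℂ) where
  carrier := {A | (A : Matrix (Fin 2) (Fin 2) ℂ)ᴴ * J * (A : Matrix (Fin 2) (Fin 2) ℂ) = J}
  one_mem' := by simp
  mul_mem' := by
    intro A B hA hB
    simp only [Set.mem_ofPred_eq, Units.val_mul, Matrix.conjTranspose_mul] at hA hB ⊢
    calc _ = (B : Matrix (Fin 2) (Fin 2) ℂ)ᴴ * ((A : Matrix (Fin 2) (Fin 2) ℂ)ᴴ * J * A) * B := by
          simp only [Matrix.mul_assoc]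
      _ = J := by rw [hA, hB]
  inv_mem' := by
    intro A hA
    simp only [Set.mem_ofPred_eq] at hA ⊢
    have h1 : (A : Matrix (Fin 2) (Fin 2) ℂ) * ((A⁻¹ : GL (Fin 2) ℂ) : Matrix (Fin 2) (Fin 2) ℂ)
        = 1 := by rw [← Units.val_mul, mul_inv_cancel, Units.val_one]
    have h2 := congrArg Matrix.conjTranspose h1
    rw [Matrix.conjTranspose_mul, Matrix.conjTranspose_one] at h2
    set B := ((A⁻¹ : GL (Fin 2) ℂ) : Matrix (Fin 2) (Fin 2) ℂ)
    calc Bᴴ * J * B = Bᴴ * ((A : Matrix (Fin 2) (Fin 2) ℂ)ᴴ * J * A) * B := by rw [hA]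
      _ = (Bᴴ * (A : Matrix (Fin 2) (Fin 2) ℂ)ᴴ) * J * (A * B) := by
          simp only [Matrix.mul_assoc]
      _ = J := by rw [h1, h2, Matrix.one_mul, Matrix.mul_one]

/-- The matrix group `SU(1,1)`. -/
def SU11 : Subgroup (GL (Fin 2) ℂ) := U11 ⊓ Matrix.GeneralLinearGroup.det.ker

/-- Matrices that satisfy the equations of `SU(1,1)`. -/
def IsSU (M : Matrix (Fin 2) (Fin 2) ℂ) : Prop := Mᴴ * J * M = J ∧ M.det = 1

theorem IsSU.shape {M : Matrix (Fin 2) (Fin 2) ℂ} (h : IsSU M) : toMat (ofMat M) = M := by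
  obtain ⟨h1, h2⟩ := h
  have hJ : J * J = 1 := by
    ext i j
    fin_cases i <;> fin_cases j <;> simp [J]
  have e1 : J * Mᴴ * J * M = 1 := by
    calc J * Mᴴ * J * M = J * (Mᴴ * J * M) := by simp only [Matrix.mul_assoc]
      _ = 1 := by rw [h1, hJ]
  have e2 : M * M.adjugate = 1 := by rw [Matrix.mul_adjugate, h2, one_smul]
  have e3 : J * Mᴴ * J = M.adjugate := by
    calc _ = J * Mᴴ * J * (M * M.adjugate) := by rw [e2, Matrix.mul_one]
      _ = (J * Mᴴ * J * M) * M.adjugate := by simp only [Matrix.mul_assoc]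
      _ = _ := by rw [e1, Matrix.one_mul]
  rw [Matrix.adjugate_fin_two] at e3
  have a := congrFun (congrFun e3 0) 0
  have b := congrFun (congrFun e3 1) 0
  simp [J, Matrix.mul_apply, Fin.sum_univ_two, Matrix.vecMul, dotProduct] at a b
  ext i j
  fin_cases i <;> fin_cases j <;> simp [toMat, ofMat, a, b]

theorem IsSU.quad_eq {M : Matrix (Fin 2) (Fin 2) ℂ} (h : IsSU M) : quad (ofMat M) = 1 := by
  have h1 : (toMat (ofMat M)).det = 1 := by rw [h.shape, h.2]
  rw [toMat, Matrix.det_fin_two_of, Complex.mul_conj, Complex.mul_conj, ← Complex.ofReal_sub]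
    at h1
  exact_mod_cast h1

theorem isSU_toMat (p : H31) : IsSU (toMat p) := by
  have hp : quad p = 1 := p.2
  have hc : (p : ℂ × ℂ).1 * starRingEnd ℂ (p : ℂ × ℂ).1 -
      (p : ℂ × ℂ).2 * starRingEnd ℂ (p : ℂ × ℂ).2 = 1 := by
    rw [Complex.mul_conj, Complex.mul_conj, ← Complex.ofReal_sub]
    exact_mod_cast hp
  constructor
  · ext i j
    fin_cases i <;> fin_cases j <;>
      simp [toMat, J, Matrix.mul_apply, Fin.sum_univ_two]
    · linear_combination hc
    · ring
    · ring
    · linear_combination -hc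
  · rw [toMat, Matrix.det_fin_two_of]
    exact hc

/-- The point of `H³₁` that corresponds to a matrix of `SU(1,1)`. -/
def pt (M : Matrix (Fin 2) (Fin 2) ℂ) (h : IsSU M) : H31 := ⟨ofMat M, h.quad_eq⟩

theorem toMat_pt {M : Matrix (Fin 2) (Fin 2) ℂ} (h : IsSU M) : toMat (pt M h) = M := h.shape

theorem toMat_injective : Function.Injective (fun p : H31 => toMat p) := by
  intro p q h
  have h0 := congrFun (congrFun h 0) 0
  have h1 := congrFun (congrFun h 0) 1
  simp [toMat] at h0 h1
  exact Subtype.ext (Prod.ext h0 h1)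

theorem IsSU.mul {M N : Matrix (Fin 2) (Fin 2) ℂ} (hM : IsSU M) (hN : IsSU N) :
    IsSU (M * N) := by
  constructor
  · calc (M * N)ᴴ * J * (M * N) = Nᴴ * (Mᴴ * J * M) * N := by
          simp only [Matrix.conjTranspose_mul, Matrix.mul_assoc]
      _ = J := by rw [hM.1, hN.1]
  · rw [Matrix.det_mul, hM.2, hN.2, one_mul]

theorem isSU_coe (A : SU11) : IsSU ((A : GL (Fin 2) ℂ) : Matrix (Fin 2) (Fin 2) ℂ) := by
  refine ⟨A.2.1, ?_⟩
  have h : Matrix.GeneralLinearGroup.det (A : GL (Fin 2) ℂ) = 1 := A.2.2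
  simpa using congrArg Units.val h

/-- The matrix `diag(e^{-is}, e^{is})`, as a function of `u = e^{is}`. -/
def rot (u : Circle) : Matrix (Fin 2) (Fin 2) ℂ :=
  !![((u⁻¹ : Circle) : ℂ), 0; 0, (u : ℂ)]

theorem isSU_rot (u : Circle) : IsSU (rot u) := by
  have h : starRingEnd ℂ (u : ℂ) * u = 1 := by
    rw [← Circle.coe_inv_eq_conj, ← Circle.coe_mul, inv_mul_cancel, Circle.coe_one]
  have h' : (starRingEnd ℂ (u : ℂ))⁻¹ * (u : ℂ)⁻¹ = 1 := by rw [← mul_inv, h, inv_one]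
  constructor
  · ext i j
    fin_cases i <;> fin_cases j <;>
      simp [rot, J, Matrix.mul_apply, Fin.sum_univ_two, h, h']
  · simp [rot, Matrix.det_fin_two_of]

/-- `SU(1,1)` acts on `H³₁ ≃ SU(1,1)` by left multiplication. -/
instance : MulAction SU11 H31 where
  smul A p := pt (((A : GL (Fin 2) ℂ) : Matrix (Fin 2) (Fin 2) ℂ) * toMat p)
    ((isSU_coe A).mul (isSU_toMat p))
  one_smul p := toMat_injective (by
    change toMat (pt _ _) = _
    rw [toMat_pt]
    simp)
  mul_smul A B p := toMat_injective (by
    change toMat (pt _ _) = toMat (pt (_ * toMat (pt _ _)) _)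
    simp only [toMat_pt]
    simp [Matrix.mul_assoc])

/-- The action `((A, e^{is}), Z) ↦ A Z diag(e^{-is}, e^{is})` of `SU(1,1) × U(1)`. -/
instance : MulAction (SU11 × Circle) H31 where
  smul x p := pt (((x.1 : GL (Fin 2) ℂ) : Matrix (Fin 2) (Fin 2) ℂ) * toMat p * rot x.2)
    (((isSU_coe x.1).mul (isSU_toMat p)).mul (isSU_rot x.2))
  one_smul p := toMat_injective (by
    change toMat (pt _ _) = _
    have h1 : rot 1 = 1 := by
      ext i j
      fin_cases i <;> fin_cases j <;> simp [rot]
    rw [toMat_pt, Prod.snd_one, h1]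
    simp)
  mul_smul x y p := toMat_injective (by
    change toMat (pt _ _) = toMat (pt (_ * toMat (pt _ _) * _) _)
    have h1 : rot (x * y).2 = rot y.2 * rot x.2 := by
      ext i j
      fin_cases i <;> fin_cases j <;> simp [rot, Matrix.mul_apply, Fin.sum_univ_two, mul_comm]
    simp only [toMat_pt, h1]
    simp [Matrix.mul_assoc])

theorem isSU_mul_diag (B : U11) (p : H31) :
    IsSU (((B : GL (Fin 2) ℂ) : Matrix (Fin 2) (Fin 2) ℂ) * toMat p *
      !![1, 0; 0, ((B : GL (Fin 2) ℂ) : Matrix (Fin 2) (Fin 2) ℂ).det⁻¹]) := by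
  have hB : ((B : GL (Fin 2) ℂ) : Matrix (Fin 2) (Fin 2) ℂ)ᴴ * J *
    ((B : GL (Fin 2) ℂ) : Matrix (Fin 2) (Fin 2) ℂ) = J := B.2
  set M := ((B : GL (Fin 2) ℂ) : Matrix (Fin 2) (Fin 2) ℂ)
  have hp := isSU_toMat p
  set Z := toMat p
  have hd : starRingEnd ℂ M.det * M.det = 1 := by
    have := congrArg Matrix.det hB
    rw [Matrix.det_mul, Matrix.det_mul, Matrix.det_conjTranspose] at this
    have hJ : J.det = -1 := by simp [J, Matrix.det_fin_two_of]
    rw [hJ] at this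
    simp only [Complex.star_def] at this
    linear_combination -this
  have hd0 : M.det ≠ 0 := fun h => by simp [h] at hd
  have hD : (!![1, 0; 0, M.det⁻¹] : Matrix (Fin 2) (Fin 2) ℂ)ᴴ * J * !![1, 0; 0, M.det⁻¹] = J := by
    have : (starRingEnd ℂ M.det)⁻¹ * (M.det)⁻¹ = 1 := by rw [← mul_inv, hd, inv_one]
    ext i j
    fin_cases i <;> fin_cases j <;> simp [J, Matrix.mul_apply, Fin.sum_univ_two, this]
  constructor
  · set D : Matrix (Fin 2) (Fin 2) ℂ := !![1, 0; 0, M.det⁻¹]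
    calc (M * Z * D)ᴴ * J * (M * Z * D) = Dᴴ * (Zᴴ * (Mᴴ * J * M) * Z) * D := by
          simp only [Matrix.conjTranspose_mul, Matrix.mul_assoc]
      _ = J := by rw [hB, hp.1, hD]
  · rw [Matrix.det_mul, Matrix.det_mul, hp.2, Matrix.det_fin_two_of]
    simp [hd0]

/-- The action `(B, Z) ↦ B Z diag(1, det(B)⁻¹)` of `U(1,1)`. -/
instance : MulAction U11 H31 where
  smul B p := pt _ (isSU_mul_diag B p)
  one_smul p := toMat_injective (by
    change toMat (pt _ _) = _
    rw [toMat_pt]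
    have h1 : (!![1, 0; 0, 1] : Matrix (Fin 2) (Fin 2) ℂ) = 1 := by
      ext i j
      fin_cases i <;> fin_cases j <;> simp
    simp [h1])
  mul_smul A B p := toMat_injective (by
    change toMat (pt _ _) = toMat (pt (_ * toMat (pt _ _) * _) _)
    simp only [toMat_pt, Subgroup.coe_mul, Units.val_mul, Matrix.det_mul, mul_inv,
      Matrix.mul_assoc]
    congr 3
    ext i j
    fin_cases i <;> fin_cases j <;> simp [Matrix.mul_apply, Fin.sum_univ_two, mul_comm])

/-- The homomorphism `(A, e^{is}) ↦ e^{-is} A` from `SU(1,1) × U(1)` to `U(1,1)`. -/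
def psi : SU11 × Circle →* U11 where
  toFun x := ⟨Matrix.GeneralLinearGroup.scalar (Fin 2) (Circle.toUnits x.2⁻¹) * x.1, by
    refine U11.mul_mem ?_ x.1.2.1
    change _ᴴ * J * _ = J
    have h : (starRingEnd ℂ (x.2 : ℂ))⁻¹ * (x.2 : ℂ)⁻¹ = 1 := by
      rw [← mul_inv, ← Circle.coe_inv_eq_conj, ← Circle.coe_mul, inv_mul_cancel, Circle.coe_one,
        inv_one]
    ext i j
    fin_cases i <;> fin_cases j <;>
      simp [J, Matrix.mul_apply, Fin.sum_univ_two, h]⟩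
  map_one' := by
    ext
    simp
  map_mul' x y := by
    ext i j
    simp [← Matrix.smul_eq_diagonal_mul]
    ring

theorem coe_psi (x : SU11 × Circle) :
    ((psi x : GL (Fin 2) ℂ) : Matrix (Fin 2) (Fin 2) ℂ) =
      ((x.2⁻¹ : Circle) : ℂ) • ((x.1 : GL (Fin 2) ℂ) : Matrix (Fin 2) (Fin 2) ℂ) := by
  ext i j
  simp [psi]

/-! ### Isometric actions, reductive decompositions and canonical connections -/

/-- `f` is an isometry of `(H³₁, g)`: it is bijective and smooth, and
`g_{f(p)}(df v, df w) = g_p(v, w)` for all tangent vectors `v`, `w` at `p` (here written as values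
of vector fields). -/
def IsIsometry (g : VField →ₗ[Smooth] VField →ₗ[Smooth] Smooth) (f : H31 → H31) : Prop :=
  Function.Bijective f ∧ ∃ hf : IsSmooth (fun p => (f p : ℂ × ℂ)),
    ∀ (p : H31) (V W V' W' : VField), V' (f p) = hf.deriv p (V p) → W' (f p) = hf.deriv p (W p) →
      g V' W' (f p) = g V W p

/-- The topological group `G` acts continuously and transitively on `H³₁` by isometries of `g`. -/
structure IsTransitiveIsometricAction (g : VField →ₗ[Smooth] VField →ₗ[Smooth] Smooth)
    (G : Type) [Group G] [TopologicalSpace G] [MulAction G H31] : Prop where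
  continuous : ContinuousSMul G H31
  isometry : ∀ a : G, IsIsometry g (fun p => a • p)
  transitive : MulAction.IsPretransitive G H31

/-- The action of `G` on `H³₁` is almost effective: the elements that act trivially form a discrete
subgroup. -/
def IsAlmostEffective (G : Type) [Group G] [TopologicalSpace G] [MulAction G H31] : Prop :=
  DiscreteTopology (MulAction.toPermHom G H31).ker

/-- The matrix exponential, as an invertible matrix. -/
def expGL (X : Matrix (Fin 2) (Fin 2) ℂ) : GL (Fin 2) ℂ :=
  (Matrix.isUnit_exp X).unit

/-- The Lie algebra `{X : exp(sX) ∈ G for all real s}` of a matrix group `G`. -/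
def lieAlg (G : Subgroup (GL (Fin 2) ℂ)) : Set (Matrix (Fin 2) (Fin 2) ℂ) :=
  {X | ∀ s : ℝ, expGL (s • X) ∈ G}

open Classical in
/-- The one-parameter subgroup `s ↦ exp(sX)` of `G`, for `X` in the Lie algebra of `G`. -/
def oneParam (G : Subgroup (GL (Fin 2) ℂ)) (X : Matrix (Fin 2) (Fin 2) ℂ) (s : ℝ) : G :=
  if h : expGL (s • X) ∈ G then ⟨expGL (s • X), h⟩ else 1

/-- The fundamental vector field `X^*`, whose value at `p` is the derivative of `exp(sX) p` at
`s = 0`, for `X` in the Lie algebra of `G`. -/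
def fund (G : Subgroup (GL (Fin 2) ℂ)) [MulAction G H31] (X : Matrix (Fin 2) (Fin 2) ℂ)
    (p : H31) : ℂ × ℂ :=
  deriv (fun s : ℝ => ((oneParam G X s • p : H31) : ℂ × ℂ)) 0

/-- The base point `o = (1, 0)`. -/
def o : H31 := ⟨(1, 0), by simp [quad]⟩

/-- The isotropy group of `G` at `o`. -/
def isotropy (G : Subgroup (GL (Fin 2) ℂ)) [MulAction G H31] : Subgroup (GL (Fin 2) ℂ) :=
  (MulAction.stabilizer G o).map G.subtype

/-- `𝔤 = 𝔥 ⊕ 𝔪` is a reductive decomposition for the action of `G` on `H³₁`: `𝔤` and `𝔥` are the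
Lie algebras of `G` and of its isotropy group `H` at `o`, and `𝔪` is an `Ad(H)`-invariant
complement. -/
structure IsReductiveDecomposition (G : Subgroup (GL (Fin 2) ℂ)) [MulAction G H31]
    (𝔥 𝔪 : Submodule ℝ (Matrix (Fin 2) (Fin 2) ℂ)) : Prop where
  lie : ((𝔥 ⊔ 𝔪 : Submodule ℝ (Matrix (Fin 2) (Fin 2) ℂ)) : Set (Matrix (Fin 2) (Fin 2) ℂ)) =
    lieAlg G
  disjoint : Disjoint 𝔥 𝔪
  isotropy_lie : (𝔥 : Set (Matrix (Fin 2) (Fin 2) ℂ)) = lieAlg (isotropy G)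
  ad : ∀ a ∈ isotropy G, ∀ X ∈ 𝔪, (a : Matrix (Fin 2) (Fin 2) ℂ) * X *
    ((a⁻¹ : GL (Fin 2) ℂ) : Matrix (Fin 2) (Fin 2) ℂ) ∈ 𝔪

/-- The connection `T` is the canonical connection of the reductive decomposition: it is
`G`-invariant and `T_{X^*} Y^* = -([X, Y]_𝔪)^*` at `o` for `X, Y ∈ 𝔪`. -/
structure IsCanonicalConnection (G : Subgroup (GL (Fin 2) ℂ)) [MulAction G H31]
    (𝔥 𝔪 : Submodule ℝ (Matrix (Fin 2) (Fin 2) ℂ)) (T : VField → VField → VField) : Prop where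
  invariant : ∀ (a : G) (ha : IsSmooth (fun p => ((a • p : H31) : ℂ × ℂ))) (V W V' W' : VField),
    (∀ p, V' (a • p) = ha.deriv p (V p)) → (∀ p, W' (a • p) = ha.deriv p (W p)) →
      ∀ p, T V' W' (a • p) = ha.deriv p (T V W p)
  eval : ∀ X ∈ 𝔪, ∀ Y ∈ 𝔪, ∃ Z ∈ 𝔪, X * Y - Y * X - Z ∈ 𝔥 ∧
    ∃ V W : VField, (∀ p, V p = fund G X p) ∧ (∀ p, W p = fund G Y p) ∧ T V W o = -fund G Z o

/-- The holonomy algebra at `o` of the connection `T = ∇ - S` of a homogeneous structure `S`,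
spanned by the curvature endomorphisms of `T` at `o`. -/
def hol (T : VField → VField → VField) : Submodule ℝ (Module.End ℝ (tangent o)) :=
  Submodule.span ℝ {L | ∃ V W : VField, ∀ Z : VField, L (Z.at' o) = (curv T V W Z).at' o}

/-- The reductive decomposition `𝔤 = 𝔥 ⊕ 𝔪` is the one induced by the homogeneous structure `S`.
On the one hand, `∇ - S` is its canonical connection. On the other hand, `𝔪` is identified with
`T_o H³₁` through `X ↦ X^*|_o` and `𝔥` is identified, through some `ρ`, with the holonomy algebra
of `∇ - S`, in such a way that the Lie bracket becomes
`[U, V] = U V - V U`, `[U, X] = U(X)` and `[X, Y] = (S_X Y - S_Y X) - R̃(X, Y)`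
for `U, V` in the holonomy algebra and `X, Y ∈ T_o H³₁`,
where `R̃` is the curvature tensor of `∇ - S`. -/
structure IsInducedDecomposition (D : VField → VField → VField)
    (S : VField →ₗ[Smooth] VField →ₗ[Smooth] VField)
    (G : Subgroup (GL (Fin 2) ℂ)) [MulAction G H31]
    (𝔥 𝔪 : Submodule ℝ (Matrix (Fin 2) (Fin 2) ℂ)) : Prop where
  reductive : IsReductiveDecomposition G 𝔥 𝔪
  canonical : IsCanonicalConnection G 𝔥 𝔪 (canon D S)
  model : ∃ (τ : 𝔪 ≃ₗ[ℝ] tangent o) (ρ : 𝔥 ≃ₗ[ℝ] hol (canon D S)),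
    (∀ X : 𝔪, (τ X : ℂ × ℂ) = fund G X o) ∧
    (∀ U V : 𝔥, ∃ W : 𝔥, (U * V - V * U : Matrix (Fin 2) (Fin 2) ℂ) = W ∧
      (ρ W : Module.End ℝ (tangent o)) = ρ U * ρ V - ρ V * ρ U) ∧
    (∀ (U : 𝔥) (X : 𝔪), ∃ Y : 𝔪, (U * X - X * U : Matrix (Fin 2) (Fin 2) ℂ) = Y ∧
      τ Y = (ρ U : Module.End ℝ (tangent o)) (τ X)) ∧
    (∀ X Y : 𝔪, ∃ (W : 𝔥) (Z : 𝔪), (X * Y - Y * X : Matrix (Fin 2) (Fin 2) ℂ) = Z + W ∧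
      ∀ V₁ V₂ : VField, V₁.at' o = τ X → V₂.at' o = τ Y →
        τ Z = (S V₁ V₂ - S V₂ V₁).at' o ∧
        ∀ V₃ : VField, (ρ W : Module.End ℝ (tangent o)) (V₃.at' o) =
          -(curv (canon D S) V₁ V₂ V₃).at' o)

/-- The subspace `𝔥 = span {diag(0, i)}` of `u(1,1)`. -/
def hIso : Submodule ℝ (Matrix (Fin 2) (Fin 2) ℂ) :=
  Submodule.span ℝ {!![0, 0; 0, Complex.I]}

/-- The subspace `𝔪 = span {diag(i, (1 + (λ - t) / μ) i), X₁, X₂}` of `u(1,1)`. -/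
def mComp (lam mu t : ℝ) : Submodule ℝ (Matrix (Fin 2) (Fin 2) ℂ) :=
  Submodule.span ℝ {!![Complex.I, 0; 0, ((1 + (lam - t) / mu : ℝ) : ℂ) * Complex.I],
    !![0, 1; 1, 0], !![0, Complex.I; -Complex.I, 0]}

/-- The Lie algebra `su(1,1) = span {X₀, X₁, X₂}`. -/
def su11 : Submodule ℝ (Matrix (Fin 2) (Fin 2) ℂ) :=
  Submodule.span ℝ {pauli 0, pauli 1, pauli 2}

end AdS

end

noncomputable section

namespace AdS

/-! ### Derivatives along lines -/

section Lines

variable {F : Type*} [NormedAddCommGroup F] [NormedSpace ℝ F]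

/-! In the left-invariant frame all the data have constant coefficients, and the theorem reduces to
one family of connections. Let D⁰ be the flat connection that makes the frame parallel; then `twist
k` is D⁰ - k θ⁰ ⊗ φ₀. The endomorphism φ₀ kills X₀ and is a quarter turn of the plane spanned by X₁
and X₂. Because μ = ν, the metric, S, φ₀, ξ₀ and η₀ are invariant under rotations of this plane, so
every `twist k` makes them parallel (`isMetricConnection_twist`, `homTensor_parallel`,
`phi0_parallel`). As D⁰ is flat and φ₀ is parallel, the curvature of `twist k` comes from dθ⁰ alone
and equals -2k (θ¹ ∧ θ²) ⊗ φ₀ (`curv_twist`).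

The Levi-Civita connection is `twist (λ/μ + 2)` plus S_λ(0), and the t-term of S_λ(t) is -(t/μ) θ⁰ ⊗
φ₀. Hence ∇ - S_λ(t) = `twist k` with k = (λ + 2μ - t)/μ (`canon_leviCivita`). The curvature of ∇ is
that of `twist k` plus terms quadratic in S (`curv_add_tensor`), so it is parallel too. The Sasakian
identity is the algebraic computation of the commutator of S_X with φ₀.

All three groups act by restrictions of real linear maps that preserve θ⁰ and rotate the pair (θ¹,
θ²) by a constant angle (`isFrameRotation_mulCLM`). Such maps are isometries and preserve every
`twist k`. The Lie algebras are found by differentiating the equations of the groups along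
exponentials.

Put κ = 1 + (λ - t)/μ, so that k = 1 + κ. The fundamental fields are combinations of right-invariant
fields and X₀, which allows the canonical connection to be evaluated at o (`twist_fundField_o`). The
holonomy algebra is spanned by k φ₀ (`mem_hol_twist`): it is a line when t ≠ λ + 2μ and zero when t
= λ + 2μ. This is the dichotomy between U(1,1) and SU(1,1). Writing 𝔥 as the matrices diag(0, (1 +
κ) c i) treats both cases at once (`exists_model`). -/

theorem hasDerivAt_comp_line {f : ℂ × ℂ → F} (hf : ContDiff ℝ ∞ f) (z v : ℂ × ℂ) :
    HasDerivAt (fun s : ℝ => f (z + s • v)) (fderiv ℝ f z v) 0 := by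
  have hl : HasDerivAt (fun s : ℝ => z + s • v) v 0 := by
    simpa using ((hasDerivAt_id (0 : ℝ)).smul_const v).const_add z
  have hd : HasFDerivAt f (fderiv ℝ f z) (z + (0 : ℝ) • v) := by
    simpa using (hf.differentiable (by simp) z).hasFDerivAt
  exact hd.comp_hasDerivAt (0 : ℝ) hl

theorem IsSmooth.hasDerivAt_line {f : H31 → F} (hf : IsSmooth f) (p : H31) (v : ℂ × ℂ) :
    HasDerivAt (fun s : ℝ => hf.ext ((p : ℂ × ℂ) + s • v)) (hf.deriv p v) 0 :=
  hasDerivAt_comp_line hf.contDiff_ext _ _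

theorem IsSmooth.deriv_eq_of_hasDerivAt {f : H31 → F} (hf : IsSmooth f) {f' : ℂ × ℂ → F}
    (hf' : ContDiff ℝ ∞ f') (h : ∀ p : H31, f p = f' p) (p : H31) {v : ℂ × ℂ}
    (hv : v ∈ tangent p) {c : F}
    (hc : HasDerivAt (fun s : ℝ => f' ((p : ℂ × ℂ) + s • v)) c 0) : hf.deriv p v = c := by
  rw [hf.deriv_eq hf' h p hv]
  exact (hasDerivAt_comp_line hf' _ _).unique hc

end Lines

/-! ### Vector fields as derivations -/

theorem act_eq_of_hasDerivAt {X : VField} {f : Smooth} {f' : ℂ × ℂ → ℝ} (hf' : ContDiff ℝ ∞ f')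
    (h : ∀ p : H31, f p = f' p) {p : H31} {c : ℝ}
    (hc : HasDerivAt (fun s : ℝ => f' ((p : ℂ × ℂ) + s • X p)) c 0) : act X f p = c :=
  f.isSmooth.deriv_eq_of_hasDerivAt hf' h p (X.mem_tangent p) hc

@[simp] theorem act_add_left (X Y : VField) (f : Smooth) : act (X + Y) f = act X f + act Y f := by
  ext p
  simp [act_apply, IsSmooth.deriv]

@[simp] theorem act_smul_left (f : Smooth) (X : VField) (h : Smooth) :
    act (f • X) h = f * act X h := by
  ext p
  simp [act_apply, IsSmooth.deriv]

@[simp] theorem act_add (X : VField) (f h : Smooth) : act X (f + h) = act X f + act X h := by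
  ext p
  refine act_eq_of_hasDerivAt (f.isSmooth.contDiff_ext.add h.isSmooth.contDiff_ext)
    (fun q => by simp [f.isSmooth.ext_apply, h.isSmooth.ext_apply]) ?_
  exact (f.isSmooth.hasDerivAt_line p (X p)).add (h.isSmooth.hasDerivAt_line p (X p))

@[simp] theorem act_mul (X : VField) (f h : Smooth) :
    act X (f * h) = act X f * h + f * act X h := by
  ext p
  refine act_eq_of_hasDerivAt (f.isSmooth.contDiff_ext.mul h.isSmooth.contDiff_ext)
    (fun q => by simp [f.isSmooth.ext_apply, h.isSmooth.ext_apply]) ?_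
  have := (f.isSmooth.hasDerivAt_line p (X p)).fun_mul (h.isSmooth.hasDerivAt_line p (X p))
  simpa [f.isSmooth.ext_apply, h.isSmooth.ext_apply, act_apply] using this

@[simp] theorem act_algebraMap (X : VField) (r : ℝ) : act X (algebraMap ℝ Smooth r) = 0 := by
  ext p
  exact act_eq_of_hasDerivAt (f' := fun _ => r) contDiff_const (fun q => by simp)
    (hasDerivAt_const _ _)

@[simp] theorem act_one (X : VField) : act X 1 = 0 := by
  simpa using act_algebraMap X 1

@[simp] theorem act_zero (X : VField) : act X 0 = 0 := by
  simpa using act_algebraMap X 0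

@[simp] theorem act_smul (X : VField) (r : ℝ) (f : Smooth) : act X (r • f) = r • act X f := by
  simp [Algebra.smul_def]

@[simp] theorem act_neg (X : VField) (f : Smooth) : act X (-f) = -act X f := by
  simpa using act_smul X (-1) f

@[simp] theorem act_sub (X : VField) (f h : Smooth) : act X (f - h) = act X f - act X h := by
  simp [sub_eq_add_neg]

/-- Vector fields act on functions through their brackets as commutators. -/
theorem act_bracket (X Y : VField) (f : Smooth) :
    act (bracket X Y) f = act X (act Y f) - act Y (act X f) := by
  have key : ∀ V W : VField, ∀ p : H31, act V (act W f) p =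
      fderiv ℝ (fderiv ℝ f.isSmooth.ext) p (V p) (W p) +
        fderiv ℝ f.isSmooth.ext p (W.isSmooth.deriv p (V p)) := by
    intro V W p
    have hf1 : ContDiff ℝ ∞ (fderiv ℝ f.isSmooth.ext) :=
      f.isSmooth.contDiff_ext.fderiv_right (m := ∞) (by simp)
    refine act_eq_of_hasDerivAt (f.isSmooth.contDiff_fderiv_ext W.isSmooth.contDiff_ext)
      (fun q => by simp only [W.isSmooth.ext_apply]; rfl) ?_
    have := (hasDerivAt_comp_line hf1 p (V p)).clm_apply (W.isSmooth.hasDerivAt_line p (V p))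
    simpa [W.isSmooth.ext_apply] using this
  ext p
  -- The second-order terms of the two iterated derivatives cancel by symmetry of the second
  -- derivative; what remains is the derivative along the bracket.
  have hs : IsSymmSndFDerivAt ℝ f.isSmooth.ext (p : ℂ × ℂ) :=
    f.isSmooth.contDiff_ext.contDiffAt.isSymmSndFDerivAt (by
      simpa using WithTop.coe_le_coe.2 (le_top : (2 : ℕ∞) ≤ ⊤))
  rw [Smooth.sub_apply, key, key, hs.eq, act_apply, IsSmooth.deriv, bracket_apply, map_sub]
  ring

/-! ### Components in the left-invariant frame -/

theorem VField.ext_coframe {V W : VField} (h : ∀ α, coframe α V = coframe α W) : V = W := by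
  rw [sum_coframe V, sum_coframe W]
  simp only [h]

theorem coframeAt_add (α : Fin 3) (z v w : ℂ × ℂ) :
    coframeAt α z (v + w) = coframeAt α z v + coframeAt α z w := by
  fin_cases α <;> simp [coframeAt] <;> ring

theorem coframeAt_sub (α : Fin 3) (z v w : ℂ × ℂ) :
    coframeAt α z (v - w) = coframeAt α z v - coframeAt α z w := by
  fin_cases α <;> simp [coframeAt] <;> ring

theorem coframeAt_smul (α : Fin 3) (z v : ℂ × ℂ) (r : ℝ) :
    coframeAt α z (r • v) = r * coframeAt α z v := by
  fin_cases α <;> simp [coframeAt] <;> ring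

theorem coframeAt_add_left (α : Fin 3) (z w v : ℂ × ℂ) :
    coframeAt α (z + w) v = coframeAt α z v + coframeAt α w v := by
  fin_cases α <;> simp [coframeAt] <;> ring

theorem coframeAt_smul_left (α : Fin 3) (r : ℝ) (z v : ℂ × ℂ) :
    coframeAt α (r • z) v = r * coframeAt α z v := by
  fin_cases α <;> simp [coframeAt] <;> ring

/-- `coframeAt α` is bounded and bilinear over the reals. -/
def coframeCLM (α : Fin 3) : (ℂ × ℂ) →L[ℝ] (ℂ × ℂ) →L[ℝ] ℝ :=
  LinearMap.toContinuousLinearMap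
    { toFun := fun z => LinearMap.toContinuousLinearMap
        { toFun := coframeAt α z
          map_add' := coframeAt_add α z
          map_smul' := fun r v => coframeAt_smul α z v r }
      map_add' := fun z w => ContinuousLinearMap.ext fun v => coframeAt_add_left α z w v
      map_smul' := fun r z => ContinuousLinearMap.ext fun v => coframeAt_smul_left α r z v }

@[simp] theorem coframeCLM_apply (α : Fin 3) (z v : ℂ × ℂ) :
    coframeCLM α z v = coframeAt α z v := rfl

theorem contDiff_coframeAt {E : Type*} [NormedAddCommGroup E] [NormedSpace ℝ E] (α : Fin 3)
    {f h : E → ℂ × ℂ} (hf : ContDiff ℝ ∞ f) (hh : ContDiff ℝ ∞ h) :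
    ContDiff ℝ ∞ (fun x => coframeAt α (f x) (h x)) :=
  ((coframeCLM α).contDiff.comp hf).clm_apply hh

theorem hasDerivAt_coframeAt (α : Fin 3) {f h : ℝ → ℂ × ℂ} {f' h' : ℂ × ℂ} {s : ℝ}
    (hf : HasDerivAt f f' s) (hh : HasDerivAt h h' s) :
    HasDerivAt (fun x => coframeAt α (f x) (h x))
      (coframeAt α f' (h s) + coframeAt α (f s) h') s :=
  ((coframeCLM α).hasFDerivAt.comp_hasDerivAt s hf).clm_apply hh

theorem act_coframe (α : Fin 3) (X Y : VField) (p : H31) :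
    act X (coframe α Y) p =
      coframeAt α (X p) (Y p) + coframeAt α p (Y.isSmooth.deriv p (X p)) := by
  refine act_eq_of_hasDerivAt (contDiff_coframeAt α contDiff_id Y.isSmooth.contDiff_ext)
    (fun q => by simp [Y.isSmooth.ext_apply]) ?_
  have hl : HasDerivAt (fun s : ℝ => (p : ℂ × ℂ) + s • X p) (X p) 0 := by
    simpa using ((hasDerivAt_id (0 : ℝ)).smul_const (X p)).const_add (p : ℂ × ℂ)
  have := hasDerivAt_coframeAt α hl (Y.isSmooth.hasDerivAt_line p (X p))
  simpa [Y.isSmooth.ext_apply] using this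

/-- The structure constants of `su(1,1)`: the components of the bracket of two vectors. -/
def structureConst (α : Fin 3) (x y : Fin 3 → ℝ) : ℝ :=
  ![-2 * (x 1 * y 2 - x 2 * y 1), 2 * (x 2 * y 0 - x 0 * y 2), 2 * (x 0 * y 1 - x 1 * y 0)] α

/-- Pointwise form of `sum_coframe`. The expansion is correct on all of ℂ² up to multiples of the
equation of the hypersurface and of the tangency condition, and both vanish here. -/
theorem tangent_eq_sum {p : H31} {v : ℂ × ℂ} (hv : v ∈ tangent p) :
    v = ∑ α, coframeAt α p v • frame α p := by
  have hp : quad p = 1 := p.2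
  rw [mem_tangent] at hv
  simp only [quad, Complex.normSq_apply] at hp
  simp only [polar] at hv
  simp only [Fin.sum_univ_three, frame_apply]
  refine Prod.ext (Complex.ext ?_ ?_) (Complex.ext ?_ ?_) <;>
    simp [coframeAt, ofMat, toMat, pauli]
  · linear_combination (-v.1.re) * hp + (p : ℂ × ℂ).1.re * hv
  · linear_combination (-v.1.im) * hp + (p : ℂ × ℂ).1.im * hv
  · linear_combination (-v.2.re) * hp + (p : ℂ × ℂ).2.re * hv
  · linear_combination (-v.2.im) * hp + (p : ℂ × ℂ).2.im * hv

theorem tangent_ext {p : H31} {v w : ℂ × ℂ} (hv : v ∈ tangent p) (hw : w ∈ tangent p)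
    (h : ∀ α, coframeAt α p v = coframeAt α p w) : v = w := by
  rw [tangent_eq_sum hv, tangent_eq_sum hw]
  simp only [h]

/-- Maurer-Cartan equation for Z⁻¹ dZ. Since `coframeAt` is bilinear over ℝ, differentiating it in
the base point just inserts the direction there, so the antisymmetrised expression is dθ up to sign.
Expanding both vectors in the frame yields the structure constants. -/
theorem coframeAt_comm (α : Fin 3) {p : H31} {v w : ℂ × ℂ} (hv : v ∈ tangent p)
    (hw : w ∈ tangent p) : coframeAt α w v - coframeAt α v w =
      structureConst α (fun β => coframeAt β p v) (fun β => coframeAt β p w) := by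
  have hp : quad p = 1 := p.2
  simp only [quad, Complex.normSq_apply] at hp
  obtain ⟨x, hx⟩ : ∃ x, x = fun β => coframeAt β p v := ⟨_, rfl⟩
  obtain ⟨y, hy⟩ : ∃ y, y = fun β => coframeAt β p w := ⟨_, rfl⟩
  have hv' : v = ∑ α, x α • frame α p := by
    rw [hx]
    exact tangent_eq_sum hv
  have hw' : w = ∑ α, y α • frame α p := by
    rw [hy]
    exact tangent_eq_sum hw
  rw [← hx, ← hy]
  rw [hv', hw']
  simp only [Fin.sum_univ_three, frame_apply]
  fin_cases α
  · simp [coframeAt, structureConst, ofMat, toMat, pauli]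
    linear_combination (-2 * (x 1 * y 2 - x 2 * y 1)) * hp
  · simp [coframeAt, structureConst, ofMat, toMat, pauli]
    linear_combination (2 * (x 2 * y 0 - x 0 * y 2)) * hp
  · simp [coframeAt, structureConst, ofMat, toMat, pauli]
    linear_combination (2 * (x 0 * y 1 - x 1 * y 0)) * hp

/-- The identity θ([X, Y]) = X θ(Y) - Y θ(X) - dθ(X, Y), with dθ given by `coframeAt_comm`. It is
the only input from the Lie algebra into torsion and curvature. -/
theorem coframe_bracket (α : Fin 3) (X Y : VField) (p : H31) :
    coframe α (bracket X Y) p = act X (coframe α Y) p - act Y (coframe α X) p +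
      structureConst α (fun β => coframe β X p) (fun β => coframe β Y p) := by
  simp only [coframe_apply]
  rw [← coframeAt_comm α (X.mem_tangent p) (Y.mem_tangent p)]
  rw [act_coframe, act_coframe, bracket_apply, coframeAt_sub]
  ring

/-- The vector field with given components. -/
def ofComp (f : Fin 3 → Smooth) : VField := ∑ α, f α • frame α

@[simp] theorem coframe_ofComp (α : Fin 3) (f : Fin 3 → Smooth) : coframe α (ofComp f) = f α := by
  simp [ofComp, coframe_frame]

theorem VField.ext_components {V W : VField} (h0 : ∀ p, coframe 0 V p = coframe 0 W p)
    (h1 : ∀ p, coframe 1 V p = coframe 1 W p) (h2 : ∀ p, coframe 2 V p = coframe 2 W p) :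
    V = W := by
  refine VField.ext_coframe fun α => ?_
  fin_cases α
  exacts [Smooth.ext h0, Smooth.ext h1, Smooth.ext h2]

/-! ### The canonical connection, the homogeneous structure and the Levi-Civita connection -/

/-- The connection for which the frame `X_α` satisfies `∇_{X₀} X₁ = k X₂`, `∇_{X₀} X₂ = -k X₁`, and
all other derivatives vanish. -/
def twist (k : ℝ) (X Y : VField) : VField :=
  ofComp ![act X (coframe 0 Y), act X (coframe 1 Y) - k • (coframe 0 X * coframe 2 Y),
    act X (coframe 2 Y) + k • (coframe 0 X * coframe 1 Y)]

@[simp] theorem coframe_zero_twist (k : ℝ) (X Y : VField) :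
    coframe 0 (twist k X Y) = act X (coframe 0 Y) := by
  simp [twist]

@[simp] theorem coframe_one_twist (k : ℝ) (X Y : VField) :
    coframe 1 (twist k X Y) = act X (coframe 1 Y) - k • (coframe 0 X * coframe 2 Y) := by
  simp [twist]

@[simp] theorem coframe_two_twist (k : ℝ) (X Y : VField) :
    coframe 2 (twist k X Y) = act X (coframe 2 Y) + k • (coframe 0 X * coframe 1 Y) := by
  simp [twist]

/-- The tensor field `S_λ(t)` of type `(1,2)` for the metric with `μ = ν`. -/
def homTensor (lam mu t : ℝ) : VField →ₗ[Smooth] VField →ₗ[Smooth] VField :=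
  LinearMap.mk₂ Smooth (fun X Y => ofComp
      ![coframe 2 X * coframe 1 Y - coframe 1 X * coframe 2 Y,
        -((lam / mu) • (coframe 2 X * coframe 0 Y)) - (t / mu) • (coframe 0 X * coframe 2 Y),
        (t / mu) • (coframe 0 X * coframe 1 Y) + (lam / mu) • (coframe 1 X * coframe 0 Y)])
    (fun _ _ _ => by
      refine VField.ext_components ?_ ?_ ?_ <;> intro p <;> simp [-coframe_apply] <;> ring)
    (fun _ _ _ => by
      refine VField.ext_components ?_ ?_ ?_ <;> intro p <;> simp [-coframe_apply] <;> ring)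
    (fun _ _ _ => by
      refine VField.ext_components ?_ ?_ ?_ <;> intro p <;> simp [-coframe_apply] <;> ring)
    (fun _ _ _ => by
      refine VField.ext_components ?_ ?_ ?_ <;> intro p <;> simp [-coframe_apply] <;> ring)

@[simp] theorem coframe_zero_homTensor (lam mu t : ℝ) (X Y : VField) :
    coframe 0 (homTensor lam mu t X Y) = coframe 2 X * coframe 1 Y - coframe 1 X * coframe 2 Y := by
  simp [homTensor]

@[simp] theorem coframe_one_homTensor (lam mu t : ℝ) (X Y : VField) :
    coframe 1 (homTensor lam mu t X Y) =
      -((lam / mu) • (coframe 2 X * coframe 0 Y)) - (t / mu) • (coframe 0 X * coframe 2 Y) := by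
  simp [homTensor]

@[simp] theorem coframe_two_homTensor (lam mu t : ℝ) (X Y : VField) :
    coframe 2 (homTensor lam mu t X Y) =
      (t / mu) • (coframe 0 X * coframe 1 Y) + (lam / mu) • (coframe 1 X * coframe 0 Y) := by
  simp [homTensor]

theorem metric_apply (lam mu nu : ℝ) (X Y : VField) :
    metric lam mu nu X Y = lam • (coframe 0 X * coframe 0 Y) + mu • (coframe 1 X * coframe 1 Y) +
      nu • (coframe 2 X * coframe 2 Y) := by
  simp [metric, tens]

theorem Slam_apply (lam t : ℝ) (X Y Z : VField) :
    Slam lam t X Y Z =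
      -lam • (coframe 2 X * (coframe 0 Y * coframe 1 Z - coframe 1 Y * coframe 0 Z)) +
      t • (coframe 0 X * (coframe 1 Y * coframe 2 Z - coframe 2 Y * coframe 1 Z)) +
      -lam • (coframe 1 X * (coframe 2 Y * coframe 0 Z - coframe 0 Y * coframe 2 Z)) := by
  ext p
  simp [Slam, tens, wedge, -coframe_apply]

/-- Raising the last index divides by λ in the X₀ component and by μ in the others. In the X₀
component the λ cancels, so only μ must be nonzero. -/
theorem metric_homTensor {mu : ℝ} (hmu : 0 < mu) (lam t : ℝ) (X Y Z : VField) :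
    metric lam mu mu (homTensor lam mu t X Y) Z = Slam lam t X Y Z := by
  rw [metric_apply, Slam_apply]
  ext p
  simp [-coframe_apply]
  field_simp
  ring

theorem isConnection_twist (k : ℝ) : IsConnection (twist k) where
  add_left X Y Z := by
    refine VField.ext_components ?_ ?_ ?_ <;> intro p <;> simp [-coframe_apply] <;> ring
  smul_left f X Y := by
    refine VField.ext_components ?_ ?_ ?_ <;> intro p <;> simp [-coframe_apply] <;> ring
  add_right X Y Z := by
    refine VField.ext_components ?_ ?_ ?_ <;> intro p <;> simp [-coframe_apply] <;> ring
  leibniz f X Y := by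
    refine VField.ext_components ?_ ?_ ?_ <;> intro p <;> simp [-coframe_apply] <;> ring

/-- The k-term is a rotation of the plane of X₁ and X₂. It is skew for the metric because θ¹ and θ²
carry the same coefficient μ. -/
theorem isMetricConnection_twist (lam mu k : ℝ) :
    IsMetricConnection (metric lam mu mu) (twist k) := by
  intro X Y Z
  simp only [metric_apply]
  ext p
  simp [-coframe_apply]
  ring

/-- The components of S are constant, and S commutes with rotations of the plane of X₁ and X₂, which
are the only connection terms of `twist k`. -/
theorem homTensor_parallel (lam mu t k : ℝ) (X Y Z : VField) :
    twist k X (homTensor lam mu t Y Z) =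
      homTensor lam mu t (twist k X Y) Z + homTensor lam mu t Y (twist k X Z) := by
  refine VField.ext_components ?_ ?_ ?_ <;> intro p <;> simp [-coframe_apply] <;> ring

/-- The factors √μ of the frame and of the coframe cancel because μ = ν, so φ₀ depends on neither λ
nor μ. -/
theorem phi0_apply {lam mu : ℝ} (hmu : 0 < mu) (X : VField) :
    phi0 lam mu mu X = ofComp ![0, coframe 2 X, -coframe 1 X] := by
  have h : √mu ≠ 0 := (Real.sqrt_pos.2 hmu).ne'
  refine VField.ext_components ?_ ?_ ?_ <;> intro p <;>
    simp [-coframe_apply, phi0, tens, onFrame, onCoframe, coframe_frame] <;>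
    field_simp

/-- The connection form -k θ⁰ ⊗ φ₀ takes values in the multiples of one parallel endomorphism, so
its curvature is -k dθ⁰ ⊗ φ₀. Here dθ⁰ = 2 θ¹ ∧ θ², since [X₁, X₂] = -2 X₀. -/
theorem curv_twist {lam mu : ℝ} (hmu : 0 < mu) (k : ℝ) (X Y Z : VField) :
    curv (twist k) X Y Z =
      (-(2 * k) • (coframe 1 X * coframe 2 Y - coframe 2 X * coframe 1 Y)) • phi0 lam mu mu Z := by
  rw [phi0_apply hmu]
  refine VField.ext_components ?_ ?_ ?_ <;> intro p <;>
    simp [-coframe_apply, curv, act_bracket, coframe_bracket, structureConst] <;> ring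

/-- The Levi-Civita connection of the metric with `μ = ν`. -/
def leviCivita (lam mu : ℝ) (X Y : VField) : VField :=
  twist (lam / mu + 2) X Y + homTensor lam mu 0 X Y

/-- The value k = λ/μ + 2 is forced by the torsion. The X₂ component of ∇_{X₀} X₁ - ∇_{X₁} X₀ is k -
λ/μ, and it must equal 2 because [X₀, X₁] = 2 X₂. -/
theorem isLeviCivita_leviCivita {lam mu : ℝ} (hmu : 0 < mu) :
    IsLeviCivita (metric lam mu mu) (leviCivita lam mu) where
  connection :=
    { add_left := fun X Y Z => by
        simp only [leviCivita, (isConnection_twist _).add_left, map_add, LinearMap.add_apply]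
        abel
      smul_left := fun f X Y => by
        simp only [leviCivita, (isConnection_twist _).smul_left, map_smul, LinearMap.smul_apply,
          smul_add]
      add_right := fun X Y Z => by
        simp only [leviCivita, (isConnection_twist _).add_right, map_add]
        abel
      leibniz := fun f X Y => by
        simp only [leviCivita, (isConnection_twist _).leibniz, map_smul, smul_add]
        abel }
  torsion_free X Y := by
    refine VField.ext_components ?_ ?_ ?_ <;> intro p <;>
      simp [-coframe_apply, leviCivita, coframe_bracket, structureConst] <;> ring
  metric X Y Z := by
    rw [isMetricConnection_twist lam mu (lam / mu + 2) X Y Z]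
    simp only [metric_apply, leviCivita]
    ext p
    simp [-coframe_apply]
    field_simp
    ring

/-- The terms of S with coefficient λ/μ, and its X₀ component, do not depend on t and cancel against
S_λ(0). The t-term has the same shape as the k-term of `twist` and lowers k by t/μ. -/
theorem canon_leviCivita {lam mu : ℝ} (hmu : 0 < mu) (t : ℝ) :
    canon (leviCivita lam mu) (homTensor lam mu t) = twist ((lam + 2 * mu - t) / mu) := by
  funext X Y
  refine VField.ext_components ?_ ?_ ?_ <;> intro p <;>
    simp [-coframe_apply, canon, leviCivita] <;> field_simp <;> ring

/-! ### Nondegeneracy of the metric and uniqueness of the Levi-Civita connection. -/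

theorem isPseudoRiemannian_metric {lam mu nu : ℝ} (hlam : lam ≠ 0) (hmu : 0 < mu) (hnu : 0 < nu) :
    IsPseudoRiemannian (metric lam mu nu) where
  symm X Y := by
    simp only [metric_apply]
    ext p
    simp
    ring
  nondegenerate p X h := by
    refine tangent_ext (X.mem_tangent p) (tangent p).zero_mem fun α => ?_
    have h0 := h (frame 0)
    have h1 := h (frame 1)
    have h2 := h (frame 2)
    simp only [metric_apply, coframe_frame] at h0 h1 h2
    simp [hlam, hmu.ne', hnu.ne'] at h0 h1 h2
    have hz : coframeAt α p 0 = 0 := by simpa using coframeAt_smul α p 0 0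
    rw [hz]
    fin_cases α
    exacts [h0, h1, h2]

theorem IsPseudoRiemannian.ext {g : VField →ₗ[Smooth] VField →ₗ[Smooth] Smooth}
    (hg : IsPseudoRiemannian g) {V W : VField} (h : ∀ Z, g V Z = g W Z) : V = W := by
  have h0 : ∀ p, (V - W) p = 0 := fun p => hg.nondegenerate p _ fun Y => by
    simp [h Y]
  exact VField.ext fun p => sub_eq_zero.1 (h0 p)

/-- The difference A of two such connections satisfies A_X Y = A_Y X by torsion-freeness, and g(A_X
Y, Z) is skew in Y and Z by metricity. A trilinear form that is symmetric in one pair of adjacent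
slots and skew in the other is zero. -/
theorem IsLeviCivita.unique {g : VField →ₗ[Smooth] VField →ₗ[Smooth] Smooth}
    (hg : IsPseudoRiemannian g) {D D' : VField → VField → VField} (hD : IsLeviCivita g D)
    (hD' : IsLeviCivita g D') : D = D' := by
  have hsymm : ∀ X Y, D X Y - D' X Y = D Y X - D' Y X := fun X Y => by
    have h := (hD.torsion_free X Y).trans (hD'.torsion_free X Y).symm
    rw [sub_eq_sub_iff_add_eq_add] at h ⊢
    rw [h, add_comm]
  have hskew : ∀ X Y Z, g (D X Y - D' X Y) Z = -g (D X Z - D' X Z) Y := fun X Y Z => by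
    have h := (hD.metric X Y Z).symm.trans (hD'.metric X Y Z)
    rw [hg.symm (D X Z - D' X Z) Y]
    simp only [map_sub, LinearMap.sub_apply]
    linear_combination h
  funext X Y
  refine hg.ext fun Z => sub_eq_zero.1 ?_
  have h2 : g (D X Y - D' X Y) Z = -g (D X Y - D' X Y) Z := by
    -- Three skew swaps alternate with three symmetric ones. Together they return the arguments to
    -- their original order with the sign (-1)³.
    conv_lhs => rw [hskew X Y Z, hsymm X Z, hskew Z X Y, hsymm Z Y, hskew Y Z X, hsymm Y X]
    simp
  have h3 : g (D X Y - D' X Y) Z = 0 := by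
    ext p
    have := congrArg (fun f : Smooth => f p) h2
    simp only [Smooth.neg_apply] at this
    simp only [Smooth.zero_apply]
    linarith
  simpa using h3

/-! ### The almost contact metric structure -/

/-- When S is parallel for T, the derivatives of S drop out. Torsion-freeness of D rewrites [X, Y]
as T_X Y - T_Y X + S_X Y - S_Y X, so the curvature of D becomes an algebraic expression in the
curvature of T and in S. -/
theorem curv_add_tensor {T D : VField → VField → VField}
    {S : VField →ₗ[Smooth] VField →ₗ[Smooth] VField} (hT : IsConnection T)
    (hTS : ∀ X Y Z, T X (S Y Z) = S (T X Y) Z + S Y (T X Z))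
    (hD : ∀ X Y, D X Y = T X Y + S X Y) (htor : ∀ X Y, D X Y - D Y X = bracket X Y)
    (X Y Z : VField) :
    curv D X Y Z = curv T X Y Z + S X (S Y Z) - S Y (S X Z) - S (S X Y) Z + S (S Y X) Z := by
  have hb : S (bracket X Y) Z = S (T X Y) Z + S (S X Y) Z - S (T Y X) Z - S (S Y X) Z := by
    rw [← htor, hD, hD]
    simp only [map_sub, map_add, LinearMap.sub_apply, LinearMap.add_apply]
    abel
  simp only [curv, hD, hT.add_right, hTS, map_add, hb]
  abel

theorem phi0_parallel {lam mu : ℝ} (hmu : 0 < mu) (k : ℝ) (X Y : VField) :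
    twist k X (phi0 lam mu mu Y) = phi0 lam mu mu (twist k X Y) := by
  simp only [phi0_apply hmu]
  refine VField.ext_components ?_ ?_ ?_ <;> intro p <;> simp [-coframe_apply]
  ring

theorem curv_twist_parallel {lam mu : ℝ} (hmu : 0 < mu) (k : ℝ) (X Y Z W : VField) :
    twist k X (curv (twist k) Y Z W) = curv (twist k) (twist k X Y) Z W +
      curv (twist k) Y (twist k X Z) W + curv (twist k) Y Z (twist k X W) := by
  simp only [curv_twist (lam := lam) hmu, (isConnection_twist k).leibniz, phi0_parallel hmu,
    ← add_smul]
  congr 2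
  ext p
  simp [-coframe_apply]
  ring

theorem isHomogeneousStructure_homTensor {lam mu : ℝ} (hmu : 0 < mu) (t : ℝ) :
    IsHomogeneousStructure (metric lam mu mu) (leviCivita lam mu) (homTensor lam mu t) where
  metric := by
    rw [canon_leviCivita hmu]
    exact isMetricConnection_twist lam mu _
  curvature X Y Z W := by
    have hc := canon_leviCivita (lam := lam) hmu t
    have hD : ∀ X Y, leviCivita lam mu X Y =
        twist ((lam + 2 * mu - t) / mu) X Y + homTensor lam mu t X Y := fun X Y => by
      rw [← hc, canon, sub_add_cancel]
    simp only [hc, curv_add_tensor (isConnection_twist _) (homTensor_parallel lam mu t _) hD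
      (isLeviCivita_leviCivita hmu).torsion_free]
    generalize (lam + 2 * mu - t) / mu = k
    have hsub : ∀ A B, twist k X (A - B) = twist k X A - twist k X B := fun A B => by
      rw [eq_sub_iff_add_eq, ← (isConnection_twist k).add_right, sub_add_cancel]
    -- Every summand of the curvature is now built from S and from the curvature of `twist k`. Both
    -- are parallel, so the derivation rule passes through each term.
    simp only [(isConnection_twist k).add_right, hsub, homTensor_parallel, map_add,
      LinearMap.add_apply, curv_twist_parallel (lam := lam) hmu]
    abel
  tensor := by
    rw [canon_leviCivita hmu]
    exact homTensor_parallel lam mu t _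

theorem sqrt_abs_ne {lam : ℝ} (hlam : lam ≠ 0) : √|lam| ≠ 0 :=
  (Real.sqrt_pos.2 (abs_pos.2 hlam)).ne'

/-- Gives ε as the constant λ/|λ|, so that both signs of λ can be treated by the same computation.
-/
theorem metric_xi0 {lam mu nu : ℝ} (hlam : lam ≠ 0) :
    metric lam mu nu (xi0 lam mu nu) (xi0 lam mu nu) = algebraMap ℝ Smooth (lam / |lam|) := by
  have h := Real.mul_self_sqrt (abs_nonneg lam)
  have h' := sqrt_abs_ne hlam
  have h'' := abs_ne_zero.2 hlam
  rw [metric_apply]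
  ext p
  simp [xi0, onFrame, coframe_frame, -coframe_apply]
  field_simp
  linear_combination -h

theorem eta0_apply (lam mu nu : ℝ) (X : VField) : eta0 lam mu nu X = √|lam| • coframe 0 X := rfl

theorem isAlmostContactMetric {lam mu : ℝ} (hlam : lam ≠ 0) (hmu : 0 < mu) :
    IsAlmostContactMetric (metric lam mu mu) (phi0 lam mu mu) (xi0 lam mu mu) (eta0 lam mu mu) where
  phi_phi X := by
    have h' := sqrt_abs_ne hlam
    simp only [phi0_apply hmu, eta0_apply]
    refine VField.ext_components ?_ ?_ ?_ <;> intro p <;>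
      simp [-coframe_apply, xi0, onFrame, coframe_frame]
    field_simp
    ring
  eta_xi := by
    rw [eta0_apply]
    ext p
    simp [-coframe_apply, xi0, onFrame, coframe_frame, sqrt_abs_ne hlam]
  xi_unit := by
    rw [metric_xi0 hlam]
    rcases lt_or_gt_of_ne hlam with h | h
    · right
      rw [abs_of_neg h, div_neg, div_self hlam, map_neg, map_one]
    · left
      rw [abs_of_pos h, div_self hlam, map_one]
  compatible X Y := by
    have h := Real.mul_self_sqrt (abs_nonneg lam)
    have h'' := abs_ne_zero.2 hlam
    rw [metric_xi0 hlam]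
    simp only [metric_apply, phi0_apply hmu, eta0_apply]
    ext p
    simp [-coframe_apply]
    field_simp
    linear_combination (coframe 0 X p * coframe 0 Y p * lam) * h

/-- Since φ₀ is parallel for `twist`, (∇_X φ₀) Y = S_X (φ₀ Y) - φ₀ (S_X Y) with S = S_λ(0), which is
purely algebraic. The normalisation of ξ₀ and η₀ contributes the factor √|λ|. -/
theorem isSasakian {lam mu : ℝ} (hlam : lam ≠ 0) (hmu : 0 < mu) :
    IsSasakian (metric lam mu mu) (leviCivita lam mu) (phi0 lam mu mu) (xi0 lam mu mu)
      (eta0 lam mu mu) (algebraMap ℝ Smooth (√|lam| / mu)) := by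
  intro X Y
  have h := Real.mul_self_sqrt (abs_nonneg lam)
  have h' := sqrt_abs_ne hlam
  have h'' := abs_ne_zero.2 hlam
  rw [metric_xi0 hlam]
  simp only [metric_apply, phi0_apply hmu, eta0_apply]
  refine VField.ext_components ?_ ?_ ?_ <;> intro p <;>
    simp [-coframe_apply, leviCivita, xi0, onFrame, coframe_frame] <;>
    field_simp
  · linear_combination (lam * coframe 0 X p * coframe 0 Y p) * h
  · linear_combination (-(coframe 1 X p * coframe 0 Y p)) * h
  · linear_combination (lam * coframe 2 X p * coframe 0 Y p) * h

theorem isHomogeneousAlmostContactMetric {lam mu : ℝ} (hlam : lam ≠ 0) (hmu : 0 < mu) (t : ℝ) :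
    IsHomogeneousAlmostContactMetric (metric lam mu mu) (leviCivita lam mu) (homTensor lam mu t)
      (phi0 lam mu mu) (xi0 lam mu mu) (eta0 lam mu mu) where
  almostContactMetric := isAlmostContactMetric hlam hmu
  homogeneous := isHomogeneousStructure_homTensor hmu t
  phi X Y := by
    rw [canon_leviCivita hmu]
    exact phi0_parallel hmu _ X Y
  xi X := by
    rw [canon_leviCivita hmu]
    refine VField.ext_components ?_ ?_ ?_ <;> intro p <;>
      simp [-coframe_apply, xi0, onFrame, coframe_frame]
  eta X Y := by
    rw [canon_leviCivita hmu]
    simp [eta0_apply]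

/-! ### Linear maps that rotate the frame -/

/-- The linear map `L` preserves the hypersurface, and `θ⁰`, and rotates `(θ¹, θ²)` by the angle
with cosine `c` and sine `s`. -/
structure IsFrameRotation (L : ℂ × ℂ →L[ℝ] ℂ × ℂ) (c s : ℝ) : Prop where
  unit : c ^ 2 + s ^ 2 = 1
  polar : ∀ z v, polar (L z) (L v) = polar z v
  zero : ∀ z v, coframeAt 0 (L z) (L v) = coframeAt 0 z v
  one : ∀ z v, coframeAt 1 (L z) (L v) = c * coframeAt 1 z v - s * coframeAt 2 z v
  two : ∀ z v, coframeAt 2 (L z) (L v) = s * coframeAt 1 z v + c * coframeAt 2 z v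

section Rotation

variable {L : ℂ × ℂ →L[ℝ] ℂ × ℂ} {c s : ℝ} {f : H31 → H31}

theorem deriv_eq_of_linear (hf : ∀ p : H31, (f p : ℂ × ℂ) = L p)
    (hs : IsSmooth (fun p => (f p : ℂ × ℂ))) (p : H31) {v : ℂ × ℂ} (hv : v ∈ tangent p) :
    hs.deriv p v = L v := by
  rw [hs.deriv_eq L.contDiff hf p hv, L.fderiv]

theorem IsFrameRotation.isIsometry (hL : IsFrameRotation L c s)
    (hf : ∀ p : H31, (f p : ℂ × ℂ) = L p) (hb : Function.Bijective f) (lam mu : ℝ) :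
    IsIsometry (metric lam mu mu) f := by
  have hs : IsSmooth (fun p => (f p : ℂ × ℂ)) := ⟨L, L.contDiff, hf⟩
  refine ⟨hb, hs, fun p V W V' W' hV hW => ?_⟩
  rw [deriv_eq_of_linear hf hs p (V.mem_tangent p)] at hV
  rw [deriv_eq_of_linear hf hs p (W.mem_tangent p)] at hW
  simp only [metric_apply, Smooth.add_apply, Smooth.smul_apply, Smooth.mul_apply, coframe_apply,
    hV, hW, hf, hL.zero, hL.one, hL.two]
  linear_combination (mu * (coframeAt 1 p (V p) * coframeAt 1 p (W p) +
    coframeAt 2 p (V p) * coframeAt 2 p (W p))) * hL.unit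

/-- Chain rule for f-related fields: an extension of g composed with the linear map L extends the
pulled-back function h. -/
theorem act_pullback (hf : ∀ p : H31, (f p : ℂ × ℂ) = L p) {V V' : VField} {g h : Smooth}
    (hgh : ∀ q, h q = g (f q)) {p : H31} (hV : V' (f p) = L (V p)) :
    act V' g (f p) = act V h p := by
  refine (act_eq_of_hasDerivAt (g.isSmooth.contDiff_ext.comp L.contDiff)
    (fun q => by rw [hgh, Function.comp_apply, ← hf, g.isSmooth.ext_apply]) ?_).symm
  have := g.isSmooth.hasDerivAt_line (f p) (V' (f p))
  rw [hV, hf] at this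
  simpa [act_apply, hV] using this

/-- Since c and s are constants, differentiating rotated components gives the rotated derivatives.
The k-term is preserved because θ⁰ is invariant and plane rotations commute with the quarter turn.
-/
theorem IsFrameRotation.twist (hL : IsFrameRotation L c s)
    (hf : ∀ p : H31, (f p : ℂ × ℂ) = L p) {V W V' W' : VField}
    (hV : ∀ p, V' (f p) = L (V p)) (hW : ∀ p, W' (f p) = L (W p)) (k : ℝ) (p : H31) :
    twist k V' W' (f p) = L (twist k V W p) := by
  have ht : ∀ v ∈ tangent p, L v ∈ tangent (f p) := fun v hv => by
    rw [mem_tangent] at hv ⊢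
    rw [hf, hL.polar, hv]
  have e0 : ∀ {U U' : VField}, (∀ p, U' (f p) = L (U p)) →
      ∀ q, coframe 0 U q = coframe 0 U' (f q) := fun hU q => by
    simp only [coframe_apply, hU, hf, hL.zero]
  have e1 : ∀ {U U' : VField}, (∀ p, U' (f p) = L (U p)) →
      ∀ q, (c • coframe 1 U - s • coframe 2 U) q = coframe 1 U' (f q) := fun hU q => by
    simp [hU, hf, hL.one]
  have e2 : ∀ {U U' : VField}, (∀ p, U' (f p) = L (U p)) →
      ∀ q, (s • coframe 1 U + c • coframe 2 U) q = coframe 2 U' (f q) := fun hU q => by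
    simp [hU, hf, hL.two]
  have a0 := act_pullback hf (e0 hW) (hV p)
  have a1 := act_pullback hf (e1 hW) (hV p)
  have a2 := act_pullback hf (e2 hW) (hV p)
  have d0 : ∀ U : VField, coframeAt 0 (f p) (U (f p)) = coframe 0 U (f p) := fun U => rfl
  have d1 : ∀ U : VField, coframeAt 1 (f p) (U (f p)) = coframe 1 U (f p) := fun U => rfl
  have d2 : ∀ U : VField, coframeAt 2 (f p) (U (f p)) = coframe 2 U (f p) := fun U => rfl
  refine tangent_ext (VField.mem_tangent _ _) (ht _ (VField.mem_tangent _ _)) fun α => ?_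
  fin_cases α
  · simp only [Fin.zero_eta, hf, hL.zero]
    rw [← hf, d0, ← coframe_apply]
    simp only [coframe_zero_twist, a0]
  · simp only [Fin.mk_one, hf, hL.one]
    rw [← hf, d1, ← coframe_apply, ← coframe_apply]
    simp only [coframe_one_twist, coframe_two_twist, Smooth.sub_apply, Smooth.add_apply,
      Smooth.smul_apply, Smooth.mul_apply, a1, ← e0 hV, ← e2 hW, act_sub, act_smul]
    ring
  · simp only [Fin.reduceFinMk, hf, hL.two]
    rw [← hf, d2, ← coframe_apply, ← coframe_apply]
    simp only [coframe_one_twist, coframe_two_twist, Smooth.sub_apply, Smooth.add_apply,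
      Smooth.smul_apply, Smooth.mul_apply, a2, ← e0 hV, ← e1 hW, act_add, act_smul]
    ring

end Rotation

/-! ### The actions -/

/-- The map `z ↦ M z N` on matrices, restricted to first rows. -/
def mulCLM (M N : Matrix (Fin 2) (Fin 2) ℂ) : ℂ × ℂ →L[ℝ] ℂ × ℂ :=
  LinearMap.toContinuousLinearMap
    { toFun := fun z => ofMat (M * toMat z * N)
      map_add' := fun z w => by
        simp [ofMat, toMat, Matrix.mul_apply, Fin.sum_univ_two]
        constructor <;> ring
      map_smul' := fun r z => by
        simp [ofMat, toMat, Matrix.mul_apply, Fin.sum_univ_two]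
        constructor <;> ring }

theorem mulCLM_apply (M N : Matrix (Fin 2) (Fin 2) ℂ) (z : ℂ × ℂ) :
    mulCLM M N z = ofMat (M * toMat z * N) := rfl

theorem conj_circle_mul (u : Circle) : starRingEnd ℂ (u : ℂ) * u = 1 := by
  rw [← Circle.coe_inv_eq_conj, ← Circle.coe_mul, inv_mul_cancel, Circle.coe_one]

/-- Two complex pairings contain all the data: z̄¹v¹ - z²v̄² has real part `polar` and imaginary
part θ⁰, and z̄¹v² - z²v̄¹ is θ¹ + iθ². Left multiplication by SU(1,1) preserves both. Right
multiplication by `rot u` preserves the first and multiplies the second by u², which gives the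
cosine and sine in the statement. -/
theorem isFrameRotation_mulCLM {M : Matrix (Fin 2) (Fin 2) ℂ} (hM : IsSU M) (u : Circle) :
    IsFrameRotation (mulCLM M (rot u)) ((u : ℂ) ^ 2).re ((u : ℂ) ^ 2).im := by
  have hu := conj_circle_mul u
  have hq : (M 0 0) * starRingEnd ℂ (M 0 0) - (M 0 1) * starRingEnd ℂ (M 0 1) = 1 := by
    have h1 : (toMat (ofMat M)).det = 1 := by rw [hM.shape, hM.2]
    rwa [toMat, Matrix.det_fin_two_of] at h1
  have hval : ∀ z, mulCLM M (rot u) z =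
      ((M 0 0 * z.1 + M 0 1 * starRingEnd ℂ z.2) * starRingEnd ℂ u,
        (M 0 0 * z.2 + M 0 1 * starRingEnd ℂ z.1) * u) := fun z => by
    simp [mulCLM_apply, ofMat, rot, toMat, Matrix.mul_apply, Fin.sum_univ_two,
      ← Circle.coe_inv_eq_conj]
  generalize M 0 0 = a at *
  generalize M 0 1 = b at *
  generalize (u : ℂ) = w at *
  have k1 : ∀ z v : ℂ × ℂ,
      starRingEnd ℂ (mulCLM M (rot u) z).1 * (mulCLM M (rot u) v).1 -
        (mulCLM M (rot u) z).2 * starRingEnd ℂ (mulCLM M (rot u) v).2 =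
      starRingEnd ℂ z.1 * v.1 - z.2 * starRingEnd ℂ v.2 := fun z v => by
    simp only [hval, map_mul, map_add, Complex.conj_conj]
    linear_combination (starRingEnd ℂ z.1 * v.1 - z.2 * starRingEnd ℂ v.2) *
      (hu * (a * starRingEnd ℂ a - b * starRingEnd ℂ b) + hq)
  have k2 : ∀ z v : ℂ × ℂ,
      starRingEnd ℂ (mulCLM M (rot u) z).1 * (mulCLM M (rot u) v).2 -
        (mulCLM M (rot u) z).2 * starRingEnd ℂ (mulCLM M (rot u) v).1 =
      w ^ 2 * (starRingEnd ℂ z.1 * v.2 - z.2 * starRingEnd ℂ v.1) := fun z v => by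
    simp only [hval, map_mul, map_add, Complex.conj_conj]
    linear_combination (starRingEnd ℂ z.1 * v.2 - z.2 * starRingEnd ℂ v.1) * w ^ 2 * hq
  have hp : ∀ z v : ℂ × ℂ, polar z v =
      (starRingEnd ℂ z.1 * v.1 - z.2 * starRingEnd ℂ v.2).re := fun z v => by
    simp [polar]
  refine ⟨?_, fun z v => ?_, fun z v => ?_, fun z v => ?_, fun z v => ?_⟩
  · have h := congrArg Complex.normSq hu
    rw [Complex.normSq_mul, Complex.normSq_conj, Complex.normSq_one, ← Complex.normSq_mul,
      ← sq, Complex.normSq_apply] at h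
    linear_combination h
  · rw [hp, hp, k1]
  · simp only [coframeAt, Matrix.cons_val_zero, k1]
  · simp only [coframeAt, Matrix.cons_val_one, Matrix.cons_val, k2, Complex.mul_re]
  · simp only [coframeAt, Matrix.cons_val_one, Matrix.cons_val, k2, Complex.mul_im]
    ring

theorem coe_smul_prod (x : SU11 × Circle) (p : H31) : ((x • p : H31) : ℂ × ℂ) =
    mulCLM ((x.1 : GL (Fin 2) ℂ) : Matrix (Fin 2) (Fin 2) ℂ) (rot x.2) p := rfl

theorem toMat_smul_prod (x : SU11 × Circle) (p : H31) : toMat (x • p : H31) =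
    ((x.1 : GL (Fin 2) ℂ) : Matrix (Fin 2) (Fin 2) ℂ) * toMat p * rot x.2 :=
  toMat_pt _

theorem toMat_smul_SU11 (A : SU11) (p : H31) : toMat (A • p : H31) =
    ((A : GL (Fin 2) ℂ) : Matrix (Fin 2) (Fin 2) ℂ) * toMat p :=
  toMat_pt _

theorem toMat_smul_U11 (B : U11) (p : H31) : toMat (B • p : H31) =
    ((B : GL (Fin 2) ℂ) : Matrix (Fin 2) (Fin 2) ℂ) * toMat p *
      !![1, 0; 0, ((B : GL (Fin 2) ℂ) : Matrix (Fin 2) (Fin 2) ℂ).det⁻¹] :=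
  toMat_pt _

theorem toMat_o : toMat (o : ℂ × ℂ) = 1 := by
  ext i j
  fin_cases i <;> fin_cases j <;> simp [toMat, o]

theorem rot_one : rot 1 = 1 := by
  ext i j
  fin_cases i <;> fin_cases j <;> simp [rot]

theorem smul_SU11_eq (A : SU11) (p : H31) : A • p = (A, (1 : Circle)) • p :=
  toMat_injective (by
    change toMat (A • p : H31) = toMat ((A, (1 : Circle)) • p : H31)
    rw [toMat_smul_SU11, toMat_smul_prod, rot_one, Matrix.mul_one])

/-- For u = e^{is}, the matrix u⁻¹A has determinant u⁻², and u⁻¹ diag(1, u²) = diag(u⁻¹, u) is `rot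
u`. -/
theorem smul_eq_psi_smul (x : SU11 × Circle) (p : H31) : x • p = psi x • p :=
  toMat_injective (by
    change toMat (x • p : H31) = toMat (psi x • p : H31)
    have hd := (isSU_coe x.1).2
    have hu : (x.2 : ℂ) ≠ 0 := Circle.coe_ne_zero x.2
    rw [toMat_smul_U11, toMat_smul_prod, coe_psi, Matrix.det_smul, hd, Matrix.smul_mul,
      Matrix.smul_mul, ← Matrix.mul_smul]
    congr 1
    ext i j
    fin_cases i <;> fin_cases j <;> simp [rot]
    field_simp)

/-- The element of `SU(1,1)` given by a matrix. -/
def IsSU.toSU {M : Matrix (Fin 2) (Fin 2) ℂ} (h : IsSU M) : SU11 :=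
  ⟨Matrix.GeneralLinearGroup.mkOfDetNeZero M (by rw [h.2]; exact one_ne_zero), h.1, by
    change Matrix.GeneralLinearGroup.det _ = 1
    ext
    exact h.2⟩

theorem IsSU.coe_toSU {M : Matrix (Fin 2) (Fin 2) ℂ} (h : IsSU M) :
    ((h.toSU : GL (Fin 2) ℂ) : Matrix (Fin 2) (Fin 2) ℂ) = M := rfl

theorem toSU_smul_o (p : H31) : (isSU_toMat p).toSU • o = p :=
  toMat_injective (by
    change toMat ((isSU_toMat p).toSU • o : H31) = toMat p
    rw [toMat_smul_SU11, toMat_o, IsSU.coe_toSU, Matrix.mul_one])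

instance isPretransitive_SU11 : MulAction.IsPretransitive SU11 H31 where
  exists_smul_eq p q := ⟨(isSU_toMat q).toSU * (isSU_toMat p).toSU⁻¹, by
    rw [mul_smul, inv_smul_eq_iff.2 (toSU_smul_o p).symm, toSU_smul_o]⟩

instance isPretransitive_prod : MulAction.IsPretransitive (SU11 × Circle) H31 where
  exists_smul_eq p q := by
    obtain ⟨A, hA⟩ := MulAction.exists_smul_eq SU11 p q
    exact ⟨(A, 1), by rw [← smul_SU11_eq, hA]⟩

instance isPretransitive_U11 : MulAction.IsPretransitive U11 H31 where
  exists_smul_eq p q := by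
    obtain ⟨x, hx⟩ := MulAction.exists_smul_eq (SU11 × Circle) p q
    exact ⟨psi x, by rw [← smul_eq_psi_smul, hx]⟩

/-! ### Surjectivity of `psi`, continuity of the actions, and transfer of isometries. -/

theorem norm_det_U11 (B : U11) :
    ‖((B : GL (Fin 2) ℂ) : Matrix (Fin 2) (Fin 2) ℂ).det‖ = 1 := by
  have hB : ((B : GL (Fin 2) ℂ) : Matrix (Fin 2) (Fin 2) ℂ)ᴴ * J *
    ((B : GL (Fin 2) ℂ) : Matrix (Fin 2) (Fin 2) ℂ) = J := B.2
  have hJ : J.det = -1 := by simp [J, Matrix.det_fin_two_of]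
  have h := congrArg (fun M => ‖Matrix.det M‖) hB
  simp only [Matrix.det_mul, Matrix.det_conjTranspose, hJ, norm_mul, norm_star, norm_neg,
    norm_one, mul_one] at h
  nlinarith [norm_nonneg ((B : GL (Fin 2) ℂ) : Matrix (Fin 2) (Fin 2) ℂ).det]

theorem psi_surjective : Function.Surjective psi := by
  intro B
  have hB : ((B : GL (Fin 2) ℂ) : Matrix (Fin 2) (Fin 2) ℂ)ᴴ * J *
    ((B : GL (Fin 2) ℂ) : Matrix (Fin 2) (Fin 2) ℂ) = J := B.2
  have hn := norm_det_U11 B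
  -- A square root u of det(B)⁻¹ has modulus one and makes det(uB) = u² det(B) equal to 1, so (uB,
  -- u) is a preimage of B.
  obtain ⟨u, hu⟩ := IsAlgClosed.exists_pow_nat_eq
    ((B : GL (Fin 2) ℂ) : Matrix (Fin 2) (Fin 2) ℂ).det⁻¹ (n := 2) two_pos
  have hun : ‖u‖ = 1 := by
    have h := congrArg norm hu
    rw [norm_pow, norm_inv, hn, inv_one] at h
    nlinarith [norm_nonneg u]
  let w : Circle := ⟨u, mem_sphere_zero_iff_norm.2 hun⟩
  have hw : starRingEnd ℂ u * u = 1 := conj_circle_mul w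
  have hd : ((B : GL (Fin 2) ℂ) : Matrix (Fin 2) (Fin 2) ℂ).det ≠ 0 := fun h => by simp [h] at hn
  have hu0 : u ≠ 0 := fun h => by simp [h] at hun
  have hA : IsSU (u • ((B : GL (Fin 2) ℂ) : Matrix (Fin 2) (Fin 2) ℂ)) := by
    constructor
    · rw [Matrix.conjTranspose_smul, Matrix.smul_mul, Matrix.smul_mul, Matrix.mul_smul, hB,
        smul_smul, Complex.star_def, hw, one_smul]
    · rw [Matrix.det_smul, Fintype.card_fin, hu, inv_mul_cancel₀ hd]
  refine ⟨(hA.toSU, w), Subtype.ext (Units.ext ?_)⟩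
  rw [coe_psi, IsSU.coe_toSU, smul_smul, Circle.coe_inv]
  change (u⁻¹ * u) • _ = _
  rw [inv_mul_cancel₀ hu0, one_smul]

theorem continuous_toMat : Continuous toMat := by
  refine continuous_matrix fun i j => ?_
  fin_cases i <;> fin_cases j <;> simp [toMat] <;> fun_prop

theorem continuous_ofMat : Continuous ofMat :=
  (continuous_id.matrix_elem 0 0).prodMk (continuous_id.matrix_elem 0 1)

theorem continuous_rot : Continuous rot := by
  refine continuous_matrix fun i j => ?_
  fin_cases i <;> fin_cases j <;> simp [rot, -Circle.coe_inv] <;> fun_prop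

instance continuousSMul_prod : ContinuousSMul (SU11 × Circle) H31 where
  continuous_smul := by
    refine Continuous.subtype_mk (continuous_ofMat.comp ?_) _
    have h1 : Continuous fun x : (SU11 × Circle) × H31 =>
        ((x.1.1 : GL (Fin 2) ℂ) : Matrix (Fin 2) (Fin 2) ℂ) :=
      Units.continuous_val.comp (continuous_subtype_val.comp (continuous_fst.comp continuous_fst))
    have h2 := continuous_toMat.comp (continuous_subtype_val.comp
      (continuous_snd (X := SU11 × Circle) (Y := H31)))
    have h3 := continuous_rot.comp ((continuous_snd (X := SU11) (Y := Circle)).comp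
      (continuous_fst (X := SU11 × Circle) (Y := H31)))
    exact (h1.matrix_mul h2).matrix_mul h3

instance continuousSMul_SU11 : ContinuousSMul SU11 H31 where
  continuous_smul := by
    refine Continuous.subtype_mk (continuous_ofMat.comp ?_) _
    have h1 : Continuous fun x : SU11 × H31 =>
        ((x.1 : GL (Fin 2) ℂ) : Matrix (Fin 2) (Fin 2) ℂ) :=
      Units.continuous_val.comp (continuous_subtype_val.comp continuous_fst)
    exact h1.matrix_mul (continuous_toMat.comp (continuous_subtype_val.comp
      (continuous_snd (X := SU11) (Y := H31))))

instance continuousSMul_U11 : ContinuousSMul U11 H31 where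
  continuous_smul := by
    refine Continuous.subtype_mk (continuous_ofMat.comp ?_) _
    have h1 : Continuous fun x : U11 × H31 =>
        ((x.1 : GL (Fin 2) ℂ) : Matrix (Fin 2) (Fin 2) ℂ) :=
      Units.continuous_val.comp (continuous_subtype_val.comp continuous_fst)
    have h2 := continuous_toMat.comp (continuous_subtype_val.comp
      (continuous_snd (X := U11) (Y := H31)))
    have h3 : Continuous fun x : U11 × H31 => (!![1, 0; 0,
        ((x.1 : GL (Fin 2) ℂ) : Matrix (Fin 2) (Fin 2) ℂ).det⁻¹] : Matrix (Fin 2) (Fin 2) ℂ) := by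
      have hd := h1.matrix_det.inv₀ fun x => by
        have := norm_det_U11 x.1
        intro h
        rw [h] at this
        simp at this
      refine continuous_matrix fun i j => ?_
      fin_cases i <;> fin_cases j <;> simp <;> first | exact continuous_const | exact hd
    exact (h1.matrix_mul h2).matrix_mul h3

theorem isTransitiveIsometricAction_prod (lam mu : ℝ) :
    IsTransitiveIsometricAction (metric lam mu mu) (SU11 × Circle) where
  continuous := inferInstance
  isometry x := (isFrameRotation_mulCLM (isSU_coe x.1) x.2).isIsometry (coe_smul_prod x)
    (MulAction.bijective x) lam mu
  transitive := inferInstance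

theorem exists_isFrameRotation_U11 (B : U11) : ∃ L c s, IsFrameRotation L c s ∧
    ∀ p : H31, ((B • p : H31) : ℂ × ℂ) = L p := by
  obtain ⟨x, rfl⟩ := psi_surjective B
  exact ⟨_, _, _, isFrameRotation_mulCLM (isSU_coe x.1) x.2, fun p => by
    rw [← smul_eq_psi_smul, coe_smul_prod]⟩

theorem exists_isFrameRotation_SU11 (A : SU11) : ∃ L c s, IsFrameRotation L c s ∧
    ∀ p : H31, ((A • p : H31) : ℂ × ℂ) = L p :=
  ⟨_, _, _, isFrameRotation_mulCLM (isSU_coe A) 1, fun p => by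
    rw [smul_SU11_eq, coe_smul_prod]⟩

theorem isTransitiveIsometricAction_U11 (lam mu : ℝ) :
    IsTransitiveIsometricAction (metric lam mu mu) U11 where
  continuous := inferInstance
  isometry B := by
    obtain ⟨L, c, s, hL, hf⟩ := exists_isFrameRotation_U11 B
    exact hL.isIsometry hf (MulAction.bijective B) lam mu
  transitive := inferInstance

theorem isTransitiveIsometricAction_SU11 (lam mu : ℝ) :
    IsTransitiveIsometricAction (metric lam mu mu) SU11 where
  continuous := inferInstance
  isometry A := by
    obtain ⟨L, c, s, hL, hf⟩ := exists_isFrameRotation_SU11 A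
    exact hL.isIsometry hf (MulAction.bijective A) lam mu
  transitive := inferInstance

/-- The point `(√2, 1)` of `H³₁`. -/
def sqrtTwoPoint : H31 := ⟨((√2 : ℝ), 1), by simp [quad, Complex.normSq_apply]; norm_num⟩

theorem toMat_sqrtTwoPoint : toMat (sqrtTwoPoint : ℂ × ℂ) =
    !![((√2 : ℝ) : ℂ), 1; 1, ((√2 : ℝ) : ℂ)] := by
  simp [toMat, sqrtTwoPoint]

/-! ### Effectiveness of the actions. -/

instance faithfulSMul_SU11 : FaithfulSMul SU11 H31 where
  eq_of_smul_eq_smul {A B} h := by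
    have h1 := congrArg (fun p : H31 => toMat p) (h o)
    simp only [toMat_smul_SU11, toMat_o, Matrix.mul_one] at h1
    exact Subtype.ext (Units.ext h1)

instance faithfulSMul_U11 : FaithfulSMul U11 H31 where
  eq_of_smul_eq_smul {A B} h := by
    have h1 := congrArg (fun p : H31 => toMat p) (h o)
    have h2 := congrArg (fun p : H31 => toMat p) (h sqrtTwoPoint)
    simp only [toMat_smul_U11, toMat_o, toMat_sqrtTwoPoint, Matrix.mul_one] at h1 h2
    have hA : ((A : GL (Fin 2) ℂ) : Matrix (Fin 2) (Fin 2) ℂ).det ≠ 0 := fun h => by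
      have hn := norm_det_U11 A
      simp [h] at hn
    have ha : ((A : GL (Fin 2) ℂ) : Matrix (Fin 2) (Fin 2) ℂ).det⁻¹ ≠ 0 := inv_ne_zero hA
    refine Subtype.ext (Units.ext ?_)
    rw [Matrix.det_fin_two] at hA
    generalize ((A : GL (Fin 2) ℂ) : Matrix (Fin 2) (Fin 2) ℂ).det⁻¹ = a at *
    generalize ((B : GL (Fin 2) ℂ) : Matrix (Fin 2) (Fin 2) ℂ).det⁻¹ = b at *
    generalize ((A : GL (Fin 2) ℂ) : Matrix (Fin 2) (Fin 2) ℂ) = M at *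
    generalize ((B : GL (Fin 2) ℂ) : Matrix (Fin 2) (Fin 2) ℂ) = N at *
    have e00 := congrFun (congrFun h1 0) 0
    have e01 := congrFun (congrFun h1 0) 1
    have e10 := congrFun (congrFun h1 1) 0
    have e11 := congrFun (congrFun h1 1) 1
    have f0 := congrFun (congrFun h2 0) 1
    have f1 := congrFun (congrFun h2 1) 1
    simp [Matrix.mul_apply, Fin.sum_univ_two] at e00 e01 e10 e11 f0 f1
    -- Equality at o identifies the first columns of M and N, and the second columns only up to the
    -- factors a and b. The point (√2, 1) mixes the two columns. A nonzero first column then forces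
    -- a = b.
    have g0 : M 0 0 * (a - b) = 0 := by
      linear_combination f0 - (√2 : ℝ) * e01 - b * e00
    have g1 : M 1 0 * (a - b) = 0 := by
      linear_combination f1 - (√2 : ℝ) * e11 - b * e10
    have hab : a = b := by
      by_contra hne
      have h0 := (mul_eq_zero.1 g0).resolve_right (sub_ne_zero.2 hne)
      have h1 := (mul_eq_zero.1 g1).resolve_right (sub_ne_zero.2 hne)
      exact hA (by rw [h0, h1]; ring)
    subst hab
    ext i j
    fin_cases i <;> fin_cases j
    exacts [e00, mul_right_cancel₀ ha e01, e10, mul_right_cancel₀ ha e11]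

theorem isAlmostEffective_prod : IsAlmostEffective (SU11 × Circle) := by
  have key : ∀ x ∈ (MulAction.toPermHom (SU11 × Circle) H31).ker,
      ((x.1 : GL (Fin 2) ℂ) : Matrix (Fin 2) (Fin 2) ℂ) * rot x.2 = 1 ∧ (x.2 : ℂ) ^ 2 = 1 := by
    intro x hx
    have h : ∀ p : H31, x • p = p := fun p => DFunLike.congr_fun (MonoidHom.mem_ker.1 hx) p
    have h1 := congrArg (fun p : H31 => toMat p) (h o)
    have h2 := congrArg (fun p : H31 => toMat p) (h sqrtTwoPoint)
    simp only [toMat_smul_prod, toMat_o, toMat_sqrtTwoPoint, Matrix.mul_one] at h1 h2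
    refine ⟨h1, ?_⟩
    -- With A = `rot u`⁻¹ known from o, fixing (√2, 1) says that its matrix commutes with `rot u`.
    -- The off-diagonal entry 1 gives u = u⁻¹.
    have h3 := congrArg (fun M => rot x.2 * M) h2
    simp only [← Matrix.mul_assoc, mul_eq_one_comm.1 h1, Matrix.one_mul] at h3
    have e := congrFun (congrFun h3 0) 1
    have hu : (x.2 : ℂ) ≠ 0 := Circle.coe_ne_zero x.2
    simp [rot, Matrix.mul_apply, Fin.sum_univ_two] at e
    rw [sq]
    nth_rw 1 [e]
    exact inv_mul_cancel₀ hu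
  -- The kernel is finite because u determines A and u is 1 or -1. A finite subset of a Hausdorff
  -- space is discrete.
  have hfin : ((MulAction.toPermHom (SU11 × Circle) H31).ker : Set (SU11 × Circle)).Finite := by
    refine Set.Finite.of_injOn (f := fun x => (x.2 : ℂ)) (t := {1, -1}) (fun x hx => ?_)
      (fun x hx y hy hxy => ?_) (Set.toFinite _)
    · simpa using sq_eq_one_iff.1 (key x hx).2
    · have h2 : x.2 = y.2 := Circle.coe_injective hxy
      refine Prod.ext (Subtype.ext (Units.ext ?_)) h2
      have hx1 := (key x hx).1
      have hy1 := mul_eq_one_comm.1 (key y hy).1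
      rw [← h2] at hy1
      exact left_inv_eq_right_inv hx1 hy1
  have := hfin.to_subtype
  change DiscreteTopology ((MulAction.toPermHom (SU11 × Circle) H31).ker : Set (SU11 × Circle))
  infer_instance

/-! ### One-parameter subgroups -/

theorem coe_expGL (X : Matrix (Fin 2) (Fin 2) ℂ) :
    (expGL X : Matrix (Fin 2) (Fin 2) ℂ) = NormedSpace.exp X := rfl

section Exp

attribute [local instance] Matrix.linftyOpNormedRing Matrix.linftyOpNormedAlgebra

theorem hasDerivAt_exp_mul_exp (X Y K : Matrix (Fin 2) (Fin 2) ℂ) (s : ℝ) :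
    HasDerivAt (fun s : ℝ => NormedSpace.exp (s • Y) * K * NormedSpace.exp (s • X))
      (NormedSpace.exp (s • Y) * (Y * K + K * X) * NormedSpace.exp (s • X)) s := by
  have h1 := (hasDerivAt_exp_smul_const (𝕂 := ℝ) Y s).mul_const K
  have h2 := hasDerivAt_exp_smul_const' (𝕂 := ℝ) X s
  refine (h1.fun_mul h2).congr_deriv ?_
  noncomm_ring

theorem hasDerivAt_exp_entry (X : Matrix (Fin 2) (Fin 2) ℂ) (i j : Fin 2) (s : ℝ) :
    HasDerivAt (fun s : ℝ => (expGL (s • X) : Matrix (Fin 2) (Fin 2) ℂ) i j)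
      ((X * (expGL (s • X) : Matrix (Fin 2) (Fin 2) ℂ)) i j) s :=
  (LinearMap.toContinuousLinearMap (Matrix.entryLinearMap ℝ ℂ i j)).hasFDerivAt.comp_hasDerivAt s
    (hasDerivAt_exp_smul_const' (𝕂 := ℝ) X s)

/-- The curve exp(sX)ᴴ J exp(sX) has derivative exp(sXᴴ)(XᴴJ + JX) exp(sX). It is constantly J
exactly when the middle factor vanishes; the derivative at 0 proves one direction and constancy the
other. -/
theorem mem_lieAlg_U11 {X : Matrix (Fin 2) (Fin 2) ℂ} :
    X ∈ lieAlg U11 ↔ Xᴴ * J + J * X = 0 := by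
  have hd := hasDerivAt_exp_mul_exp X Xᴴ J
  have hstar : ∀ s : ℝ, (NormedSpace.exp (s • X))ᴴ = NormedSpace.exp (s • Xᴴ) := fun s => by
    rw [← Matrix.exp_conjTranspose, Matrix.conjTranspose_smul, star_trivial]
  have hmem : X ∈ lieAlg U11 ↔
      ∀ s : ℝ, NormedSpace.exp (s • Xᴴ) * J * NormedSpace.exp (s • X) = J := by
    simp only [← hstar]
    rfl
  rw [hmem]
  constructor
  · intro h
    have h0 := hd 0
    simp only [h] at h0
    simpa using h0.unique (hasDerivAt_const _ _)
  · intro h s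
    have hc := is_const_of_deriv_eq_zero (fun s => (hd s).differentiableAt)
      (fun s => by rw [(hd s).deriv, h, mul_zero, zero_mul]) s 0
    simpa using hc

end Exp

theorem expGL_zero : expGL 0 = 1 := by
  ext1
  rw [coe_expGL, NormedSpace.exp_zero]
  rfl

theorem hasDerivAt_exp_entry_zero (X : Matrix (Fin 2) (Fin 2) ℂ) (i j : Fin 2) :
    HasDerivAt (fun s : ℝ => (expGL (s • X) : Matrix (Fin 2) (Fin 2) ℂ) i j) (X i j) 0 := by
  simpa [expGL_zero] using hasDerivAt_exp_entry X i j 0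

/-- Liouville's formula, by the product rule on the 2 × 2 determinant. It supplies the trace
condition of su(1,1) and the derivative of det⁻¹ in the action of U(1,1). -/
theorem hasDerivAt_det_exp (X : Matrix (Fin 2) (Fin 2) ℂ) (s : ℝ) :
    HasDerivAt (fun s : ℝ => (expGL (s • X) : Matrix (Fin 2) (Fin 2) ℂ).det)
      (X.trace * (expGL (s • X) : Matrix (Fin 2) (Fin 2) ℂ).det) s := by
  have h := ((hasDerivAt_exp_entry X 0 0 s).fun_mul (hasDerivAt_exp_entry X 1 1 s)).fun_sub
    ((hasDerivAt_exp_entry X 0 1 s).fun_mul (hasDerivAt_exp_entry X 1 0 s))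
  simp only [Matrix.det_fin_two]
  refine h.congr_deriv ?_
  simp only [Matrix.trace_fin_two, Matrix.mul_apply, Fin.sum_univ_two]
  ring

theorem mem_lieAlg_SU11 {X : Matrix (Fin 2) (Fin 2) ℂ} :
    X ∈ lieAlg SU11 ↔ Xᴴ * J + J * X = 0 ∧ X.trace = 0 := by
  have hdet : ∀ s : ℝ, expGL (s • X) ∈ SU11 ↔
      expGL (s • X) ∈ U11 ∧ (expGL (s • X) : Matrix (Fin 2) (Fin 2) ℂ).det = 1 := fun s => by
    rw [SU11, Subgroup.mem_inf, MonoidHom.mem_ker, Units.ext_iff]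
    rfl
  have hmem : X ∈ lieAlg SU11 ↔ X ∈ lieAlg U11 ∧
      ∀ s : ℝ, (expGL (s • X) : Matrix (Fin 2) (Fin 2) ℂ).det = 1 := by
    simp only [lieAlg, Set.mem_ofPred_eq, hdet, forall_and]
  rw [hmem, mem_lieAlg_U11]
  refine and_congr_right fun _ => ⟨fun h => ?_, fun h s => ?_⟩
  · have h0 := hasDerivAt_det_exp X 0
    simp only [h] at h0
    simpa using h0.unique (hasDerivAt_const _ _)
  · have hc := is_const_of_deriv_eq_zero (fun s => (hasDerivAt_det_exp X s).differentiableAt)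
      (fun s => by rw [(hasDerivAt_det_exp X s).deriv, h, zero_mul]) s 0
    simpa [expGL_zero] using hc

/-- The matrices of `u(1,1)`, in coordinates. -/
def uMat (a b x y : ℝ) : Matrix (Fin 2) (Fin 2) ℂ :=
  !![a * Complex.I, x + y * Complex.I; x - y * Complex.I, b * Complex.I]

theorem mem_lieAlg_U11_iff {X : Matrix (Fin 2) (Fin 2) ℂ} :
    X ∈ lieAlg U11 ↔ ∃ a b x y : ℝ, X = uMat a b x y := by
  rw [mem_lieAlg_U11]
  constructor
  · intro h
    have h0 := congrFun (congrFun h 0) 0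
    have h1 := congrFun (congrFun h 0) 1
    have h2 := congrFun (congrFun h 1) 1
    simp [J, Matrix.mul_apply, Fin.sum_univ_two, Matrix.vecMul, dotProduct,
      Complex.ext_iff] at h0 h1 h2
    refine ⟨(X 0 0).im, (X 1 1).im, (X 0 1).re, (X 0 1).im, ?_⟩
    ext i j
    fin_cases i <;> fin_cases j <;> simp [uMat, Complex.ext_iff] <;>
      first | (constructor <;> linarith) | linarith
  · rintro ⟨a, b, x, y, rfl⟩
    ext i j
    fin_cases i <;> fin_cases j <;>
      simp [uMat, J, Matrix.mul_apply, Fin.sum_univ_two, Complex.ext_iff]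

theorem mem_lieAlg_SU11_iff {X : Matrix (Fin 2) (Fin 2) ℂ} :
    X ∈ lieAlg SU11 ↔ ∃ a x y : ℝ, X = uMat a (-a) x y := by
  rw [mem_lieAlg_SU11, ← mem_lieAlg_U11, mem_lieAlg_U11_iff]
  constructor
  · rintro ⟨⟨a, b, x, y, rfl⟩, h⟩
    have hb : b = -a := by
      simp [uMat, Matrix.trace_fin_two, Complex.ext_iff] at h
      linarith
    exact ⟨a, x, y, by rw [hb]⟩
  · rintro ⟨a, x, y, rfl⟩
    exact ⟨⟨a, -a, x, y, rfl⟩, by simp [uMat, Matrix.trace_fin_two]⟩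

/-! ### Isotropy groups at o and their Lie algebras. -/

theorem mem_isotropy_SU11 {A : GL (Fin 2) ℂ} : A ∈ isotropy SU11 ↔ A = 1 := by
  constructor
  · rintro ⟨B, hB, rfl⟩
    have hB' : B • o = (1 : SU11) • o := by
      rw [one_smul]
      exact hB
    have h := congrArg (fun p : H31 => toMat p) hB'
    simp only [toMat_smul_SU11, toMat_o, Matrix.mul_one] at h
    exact Units.ext h
  · rintro rfl
    exact one_mem _

theorem mem_isotropy_U11 {A : GL (Fin 2) ℂ} : A ∈ isotropy U11 ↔ A ∈ U11 ∧
    (A : Matrix (Fin 2) (Fin 2) ℂ) 0 0 = 1 ∧ (A : Matrix (Fin 2) (Fin 2) ℂ) 0 1 = 0 ∧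
      (A : Matrix (Fin 2) (Fin 2) ℂ) 1 0 = 0 := by
  have key : ∀ B : U11, B • o = o ↔ ((B : GL (Fin 2) ℂ) : Matrix (Fin 2) (Fin 2) ℂ) 0 0 = 1 ∧
      ((B : GL (Fin 2) ℂ) : Matrix (Fin 2) (Fin 2) ℂ) 0 1 = 0 ∧
      ((B : GL (Fin 2) ℂ) : Matrix (Fin 2) (Fin 2) ℂ) 1 0 = 0 := fun B => by
    have hn := norm_det_U11 B
    have hd : ((B : GL (Fin 2) ℂ) : Matrix (Fin 2) (Fin 2) ℂ).det ≠ 0 := fun h => by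
      simp [h] at hn
    rw [← toMat_injective.eq_iff]
    simp only [toMat_smul_U11, toMat_o, Matrix.mul_one]
    constructor
    · intro h
      have e0 := congrFun (congrFun h 0) 0
      have e1 := congrFun (congrFun h 0) 1
      have e2 := congrFun (congrFun h 1) 0
      simp [Matrix.mul_apply, Fin.sum_univ_two, hd] at e0 e1 e2
      exact ⟨e0, e1, e2⟩
    · rintro ⟨e0, e1, e2⟩
      have h11 : ((B : GL (Fin 2) ℂ) : Matrix (Fin 2) (Fin 2) ℂ).det =
          ((B : GL (Fin 2) ℂ) : Matrix (Fin 2) (Fin 2) ℂ) 1 1 := by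
        rw [Matrix.det_fin_two, e0, e1]
        ring
      ext i j
      fin_cases i <;> fin_cases j <;>
        simp [Matrix.mul_apply, Fin.sum_univ_two, e0, e1, e2]
      rw [← h11, mul_inv_cancel₀ hd]
  constructor
  · rintro ⟨B, hB, rfl⟩
    exact ⟨B.2, (key B).1 hB⟩
  · rintro ⟨hA, h⟩
    exact ⟨⟨A, hA⟩, (key ⟨A, hA⟩).2 h, rfl⟩

theorem lieAlg_isotropy_SU11 : lieAlg (isotropy SU11) = {0} := by
  ext X
  simp only [lieAlg, Set.mem_ofPred_eq, Set.mem_singleton_iff, mem_isotropy_SU11]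
  constructor
  · intro h
    ext i j
    have h0 := hasDerivAt_exp_entry_zero X i j
    simp only [h] at h0
    simpa using h0.unique (hasDerivAt_const _ _)
  · rintro rfl s
    rw [smul_zero, expGL_zero]

theorem mem_lieAlg_isotropy_U11 {X : Matrix (Fin 2) (Fin 2) ℂ} :
    X ∈ lieAlg (isotropy U11) ↔ ∃ b : ℝ, X = uMat 0 b 0 0 := by
  constructor
  · intro h
    have h' : ∀ s : ℝ, _ := fun s => mem_isotropy_U11.1 (h s)
    obtain ⟨a, b, x, y, rfl⟩ := mem_lieAlg_U11_iff.1 fun s => (h' s).1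
    have h0 := hasDerivAt_exp_entry_zero (uMat a b x y) 0 0
    have h1 := hasDerivAt_exp_entry_zero (uMat a b x y) 0 1
    simp only [fun s => (h' s).2.1] at h0
    simp only [fun s => (h' s).2.2.1] at h1
    have e0 := h0.unique (hasDerivAt_const _ _)
    have e1 := h1.unique (hasDerivAt_const _ _)
    simp [uMat, Complex.ext_iff] at e0 e1
    exact ⟨b, by rw [e0, e1.1, e1.2]⟩
  · rintro ⟨b, rfl⟩ s
    refine mem_isotropy_U11.2 ⟨mem_lieAlg_U11_iff.2 ⟨0, b, 0, 0, rfl⟩ s, ?_⟩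
    have hdiag : s • uMat 0 b 0 0 = Matrix.diagonal ![0, s * (b * Complex.I)] := by
      ext i j
      fin_cases i <;> fin_cases j <;> simp [uMat]
    rw [coe_expGL, hdiag, Matrix.exp_diagonal]
    simp [NormedSpace.exp_zero, Pi.coe_exp]

/-! ### Fundamental vector fields -/

theorem coe_oneParam {G : Subgroup (GL (Fin 2) ℂ)} {X : Matrix (Fin 2) (Fin 2) ℂ}
    (hX : X ∈ lieAlg G) (s : ℝ) : oneParam G X s = ⟨expGL (s • X), hX s⟩ := dif_pos _

theorem fund_SU11 {X : Matrix (Fin 2) (Fin 2) ℂ} (hX : X ∈ lieAlg SU11) (p : H31) :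
    fund SU11 X p = ofMat (X * toMat p) := by
  have h00 := hasDerivAt_exp_entry_zero X 0 0
  have h01 := hasDerivAt_exp_entry_zero X 0 1
  have h := ((h00.mul_const (p : ℂ × ℂ).1).fun_add
    (h01.mul_const (starRingEnd ℂ (p : ℂ × ℂ).2))).prodMk
    ((h00.mul_const (p : ℂ × ℂ).2).fun_add (h01.mul_const (starRingEnd ℂ (p : ℂ × ℂ).1)))
  rw [fund]
  refine (congrArg (fun f => deriv f 0) (funext fun s => ?_)).trans (h.deriv.trans ?_)
  · rw [coe_oneParam hX]
    change ofMat ((expGL (s • X) : Matrix (Fin 2) (Fin 2) ℂ) * toMat p) = _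
    simp [ofMat, toMat, Matrix.mul_apply, Fin.sum_univ_two]
  · simp [ofMat, toMat, Matrix.mul_apply, Fin.sum_univ_two]

/-- The correction term comes from the right factor diag(1, det⁻¹), whose derivative at the identity
is diag(0, -tr X). -/
theorem fund_U11 {X : Matrix (Fin 2) (Fin 2) ℂ} (hX : X ∈ lieAlg U11) (p : H31) :
    fund U11 X p = ofMat (X * toMat p) - (0, X.trace * (p : ℂ × ℂ).2) := by
  have h00 := hasDerivAt_exp_entry_zero X 0 0
  have h01 := hasDerivAt_exp_entry_zero X 0 1
  have hd : HasDerivAt (fun s : ℝ => (expGL (s • X) : Matrix (Fin 2) (Fin 2) ℂ).det⁻¹)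
      (-X.trace) 0 := by
    simpa [expGL_zero] using (hasDerivAt_det_exp X 0).fun_inv (by simp [expGL_zero])
  have h := ((h00.mul_const (p : ℂ × ℂ).1).fun_add
    (h01.mul_const (starRingEnd ℂ (p : ℂ × ℂ).2))).prodMk
    (((h00.mul_const (p : ℂ × ℂ).2).fun_add
      (h01.mul_const (starRingEnd ℂ (p : ℂ × ℂ).1))).fun_mul hd)
  rw [fund]
  refine (congrArg (fun f => deriv f 0) (funext fun s => ?_)).trans (h.deriv.trans ?_)
  · rw [coe_oneParam hX]
    change ofMat ((expGL (s • X) : Matrix (Fin 2) (Fin 2) ℂ) * toMat p *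
      !![1, 0; 0, (expGL (s • X) : Matrix (Fin 2) (Fin 2) ℂ).det⁻¹]) = _
    simp [ofMat, toMat, Matrix.mul_apply, Fin.sum_univ_two]
  · simp [ofMat, toMat, Matrix.mul_apply, Fin.sum_univ_two, expGL_zero]
    ring

/-! ### Right-invariant vector fields and the canonical connection at the base point -/

/-- The right-invariant vector field whose value at the matrix `Z` is `X_α Z`. -/
def rightFrame (α : Fin 3) : VField :=
  VField.mk (fun p => mulCLM (pauli α) 1 p)
    ⟨mulCLM (pauli α) 1, (mulCLM _ _).contDiff, fun _ => rfl⟩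
    (fun p => by
      rw [mem_tangent]
      fin_cases α <;> simp [mulCLM_apply, pauli, ofMat, toMat, polar] <;> ring)

theorem rightFrame_apply (α : Fin 3) (p : H31) : rightFrame α p = mulCLM (pauli α) 1 p := rfl

theorem deriv_rightFrame (α : Fin 3) (p : H31) {v : ℂ × ℂ} (hv : v ∈ tangent p) :
    (rightFrame α).isSmooth.deriv p v = mulCLM (pauli α) 1 v := by
  rw [(rightFrame α).isSmooth.deriv_eq (mulCLM (pauli α) 1).contDiff (fun _ => rfl) p hv,
    ContinuousLinearMap.fderiv]

theorem IsConnection.real_smul_right {D : VField → VField → VField} (hD : IsConnection D) (r : ℝ)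
    (X Y : VField) : D X (r • Y) = r • D X Y := by
  rw [← algebraMap_smul Smooth r Y, hD.leibniz, act_algebraMap, zero_smul, zero_add,
    algebraMap_smul]

theorem apply_o_eq {V : VField} {a x y : ℝ} (h0 : coframe 0 V o = a) (h1 : coframe 1 V o = x)
    (h2 : coframe 2 V o = y) : V o = (a * Complex.I, x + y * Complex.I) := by
  have h := tangent_eq_sum (V.mem_tangent o)
  simp only [← coframe_apply, Fin.sum_univ_three, h0, h1, h2, frame_apply, toMat_o] at h
  rw [h]
  simp [ofMat, pauli]

theorem coframeAt_o (v : ℂ × ℂ) :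
    coframeAt 0 o v = v.1.im ∧ coframeAt 1 o v = v.2.re ∧ coframeAt 2 o v = v.2.im := by
  simp [coframeAt, o]

/-- Right-invariant fields are restrictions of linear maps, so their derivatives at o are explicit
and only the value of V at o enters. The left-invariant field X₀ is parallel for every k. -/
theorem twist_rightFrame_o (k : ℝ) {V : VField} {a x y : ℝ}
    (hV : V o = (a * Complex.I, x + y * Complex.I)) :
    twist k V (rightFrame 0) o = (0, -2 * y + 2 * x * Complex.I) ∧
    twist k V (rightFrame 1) o = (-2 * y * Complex.I, (k - 2) * a * Complex.I) ∧
    twist k V (rightFrame 2) o = (2 * x * Complex.I, (2 - k : ℂ) * a) ∧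
    twist k V (frame 0) o = 0 := by
  have ho : (o : ℂ × ℂ) = (1, 0) := rfl
  have ha : ∀ α β, act V (coframe α (rightFrame β)) o =
      coframeAt α (V o) (rightFrame β o) + coframeAt α o (mulCLM (pauli β) 1 (V o)) :=
    fun α β => by rw [act_coframe, deriv_rightFrame β o (V.mem_tangent o)]
  refine ⟨?_, ?_, ?_, ?_⟩
  · rw [apply_o_eq (a := 0) (x := -2 * y) (y := 2 * x)]
    · simp
    all_goals
      simp [ha, rightFrame_apply, mulCLM_apply, hV, ho, coframeAt, ofMat, toMat, pauli]
    all_goals ring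
  · rw [apply_o_eq (a := -2 * y) (x := 0) (y := (k - 2) * a)]
    · simp
    all_goals
      simp [ha, rightFrame_apply, mulCLM_apply, hV, ho, coframeAt, ofMat, toMat, pauli]
    all_goals ring
  · rw [apply_o_eq (a := 2 * x) (x := (2 - k) * a) (y := 0)]
    · simp
    all_goals
      simp [ha, rightFrame_apply, mulCLM_apply, hV, ho, coframeAt, ofMat, toMat, pauli]
    all_goals ring
  · rw [apply_o_eq (a := 0) (x := 0) (y := 0)]
    · simp
    all_goals
      simp [coframe_frame, -coframe_apply]

/-- The fundamental vector field of the matrix `uMat a (κ a) x y`. -/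
def fundField (κ a x y : ℝ) : VField :=
  (a * (1 - κ) / 2) • rightFrame 0 + x • rightFrame 1 + y • rightFrame 2 +
    (a * (1 + κ) / 2) • frame 0

/-- The diagonal part diag(ai, κai) splits into a(1 - κ)/2 times X₀ and a scalar matrix ci with c =
a(1 + κ)/2. The trace-free part acts from the left. The scalar acts by Z ↦ Z diag(ci, -ci), which is
c times the left-invariant X₀. -/
theorem fundField_apply (κ a x y : ℝ) (p : H31) : fundField κ a x y p =
    ofMat (uMat a (κ * a) x y * toMat p) -
      (0, (uMat a (κ * a) x y).trace * (p : ℂ × ℂ).2) := by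
  simp [fundField, rightFrame_apply, mulCLM_apply, ofMat, toMat, uMat, pauli,
    Matrix.trace_fin_two]
  constructor <;> ring

theorem fund_U11_uMat (κ a x y : ℝ) (p : H31) :
    fund U11 (uMat a (κ * a) x y) p = fundField κ a x y p := by
  rw [fund_U11 (mem_lieAlg_U11_iff.2 ⟨_, _, _, _, rfl⟩), fundField_apply]

theorem fund_SU11_uMat (a x y : ℝ) (p : H31) :
    fund SU11 (uMat a (-1 * a) x y) p = fundField (-1) a x y p := by
  rw [fund_SU11 (mem_lieAlg_SU11_iff.2 ⟨a, x, y, by rw [neg_one_mul]⟩), fundField_apply]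
  have h : (uMat a (-1 * a) x y).trace = 0 := by simp [uMat, Matrix.trace_fin_two]
  rw [h, zero_mul]
  exact (sub_zero _).symm

theorem fundField_o (κ a x y : ℝ) :
    fundField κ a x y o = (a * Complex.I, x + y * Complex.I) := by
  rw [fundField_apply, toMat_o]
  simp [o, ofMat, uMat]

theorem twist_fundField_o (κ a x y a' x' y' : ℝ) :
    twist (1 + κ) (fundField κ a x y) (fundField κ a' x' y') o =
      -fundField κ (2 * (y * x' - x * y')) ((κ - 1) * (a * y' - a' * y))
        ((1 - κ) * (a * x' - a' * x)) o := by
  obtain ⟨h0, h1, h2, h3⟩ := twist_rightFrame_o (1 + κ) (fundField_o κ a x y)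
  have hT := isConnection_twist (1 + κ)
  rw [fundField_o]
  -- Only the differentiated field is expanded; the direction matters only through its value at o.
  conv_lhs => rw [fundField.eq_def κ a' x' y']
  simp only [hT.add_right, hT.real_smul_right, VField.add_apply, VField.real_smul_apply, h0, h1,
    h2, h3]
  refine Prod.ext (Complex.ext ?_ ?_) (Complex.ext ?_ ?_) <;> simp <;> ring

/-! ### The holonomy algebra -/

/-- The endomorphism `φ₀` of the tangent space at `o`. -/
def phiAt : Module.End ℝ (tangent o) where
  toFun v := ⟨(0, -(Complex.I * (v : ℂ × ℂ).2)), by simp [mem_tangent, polar, o]⟩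
  map_add' v w := by
    ext1
    simp
    ring
  map_smul' r v := by
    ext1
    simp
    ring

theorem phi0_at_o {lam mu : ℝ} (hmu : 0 < mu) (Z : VField) :
    (phi0 lam mu mu Z).at' o = phiAt (Z.at' o) := by
  obtain ⟨-, h1, h2⟩ := coframeAt_o (Z o)
  refine Subtype.ext ?_
  change phi0 lam mu mu Z o = (0, -(Complex.I * (Z o).2))
  rw [phi0_apply hmu, apply_o_eq (a := 0) (x := (Z o).2.im) (y := -(Z o).2.re)]
  · refine Prod.ext ?_ (Complex.ext ?_ ?_) <;> simp
  · simp
  · simp [h2]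
  · simp [h1]

theorem exists_at_o (v : tangent o) : ∃ V : VField, V.at' o = v :=
  ⟨∑ α, coframeAt α o v • frame α, Subtype.ext (by
    refine Eq.trans ?_ (tangent_eq_sum v.2).symm
    simp [VField.at', Fin.sum_univ_three])⟩

theorem curv_twist_at_o (k : ℝ) (X Y Z : VField) :
    (curv (twist k) X Y Z).at' o =
      (-(2 * k) * ((X o).2.re * (Y o).2.im - (X o).2.im * (Y o).2.re)) • phiAt (Z.at' o) := by
  obtain ⟨-, h1, h2⟩ := coframeAt_o (X o)
  obtain ⟨-, h3, h4⟩ := coframeAt_o (Y o)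
  rw [curv_twist (lam := 1) one_pos, ← phi0_at_o (lam := 1) one_pos]
  refine Subtype.ext ((VField.smul_apply _ _ _).trans
    (congrArg (fun r : ℝ => r • phi0 1 1 1 Z o) ?_))
  simp [h1, h2, h3, h4]

/-- The coefficient is kept as k c so that the statement also covers k = 0, where the holonomy
algebra vanishes. -/
theorem mem_hol_twist {k : ℝ} {L : Module.End ℝ (tangent o)} :
    L ∈ hol (twist k) ↔ ∃ c : ℝ, L = (k * c) • phiAt := by
  constructor
  · intro h
    have hle : hol (twist k) ≤ Submodule.span ℝ {k • phiAt} := by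
      refine Submodule.span_le.2 ?_
      rintro M ⟨V, W, hM⟩
      refine Submodule.mem_span_singleton.2
        ⟨-2 * ((V o).2.re * (W o).2.im - (V o).2.im * (W o).2.re), LinearMap.ext fun v => ?_⟩
      obtain ⟨Z, rfl⟩ := exists_at_o v
      rw [hM, curv_twist_at_o, smul_smul, LinearMap.smul_apply]
      congr 1
      ring
    obtain ⟨c, rfl⟩ := Submodule.mem_span_singleton.1 (hle h)
    exact ⟨c, by rw [smul_smul, mul_comm]⟩
  · rintro ⟨c, rfl⟩
    have h : (-(2 * k)) • phiAt ∈ hol (twist k) :=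
      Submodule.subset_span ⟨frame 1, frame 2, fun Z => by
        have h1 : -(2 * k) * ((frame 1 o).2.re * (frame 2 o).2.im -
            (frame 1 o).2.im * (frame 2 o).2.re) = -(2 * k) := by
          simp [ofMat, pauli, toMat_o]
        rw [curv_twist_at_o, LinearMap.smul_apply, h1]⟩
    -- The pair X₁, X₂ realises the endomorphism -2k φ₀, so the factor -c/2 produces k c φ₀.
    have h' := Submodule.smul_mem _ (-c / 2) h
    rw [smul_smul] at h'
    convert h' using 2
    ring

theorem smul_phiAt_injective : Function.Injective fun r : ℝ => r • phiAt := by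
  intro r s h
  have h1 := congrArg Subtype.val
    (LinearMap.congr_fun h ⟨(0, 1), by simp [mem_tangent, polar, o]⟩)
  change r • ((0, -(Complex.I * 1)) : ℂ × ℂ) = s • ((0, -(Complex.I * 1)) : ℂ × ℂ) at h1
  simpa using h1

/-! ### Induced decompositions -/

theorem uMat_injective {a b x y a' b' x' y' : ℝ} (h : uMat a b x y = uMat a' b' x' y') :
    a = a' ∧ b = b' ∧ x = x' ∧ y = y' := by
  have h0 := congrFun (congrFun h 0) 0
  have h1 := congrFun (congrFun h 0) 1
  have h2 := congrFun (congrFun h 1) 1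
  simp [uMat, Complex.ext_iff] at h0 h1 h2
  exact ⟨h0, h2, h1⟩

theorem uMat_add (a b x y a' b' x' y' : ℝ) :
    uMat a b x y + uMat a' b' x' y' = uMat (a + a') (b + b') (x + x') (y + y') := by
  ext i j
  fin_cases i <;> fin_cases j <;> simp [uMat] <;> ring

theorem uMat_commutator (a b x y a' b' x' y' : ℝ) :
    uMat a b x y * uMat a' b' x' y' - uMat a' b' x' y' * uMat a b x y =
      uMat (2 * (y * x' - x * y')) (-(2 * (y * x' - x * y')))
        (-((a - b) * y' - (a' - b') * y)) ((a - b) * x' - (a' - b') * x) := by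
  ext i j
  fin_cases i <;> fin_cases j <;> simp [uMat] <;>
    ring_nf <;> simp <;> ring

theorem ofMat_uMat (a b x y : ℝ) :
    ofMat (uMat a b x y) = (a * Complex.I, x + y * Complex.I) := rfl

section Induced

variable {lam mu t κ : ℝ} {G : Subgroup (GL (Fin 2) ℂ)} [MulAction G H31]
  {𝔥 𝔪 : Submodule ℝ (Matrix (Fin 2) (Fin 2) ℂ)}

theorem isCanonicalConnection_twist
    (hm : ∀ X, X ∈ 𝔪 ↔ ∃ a x y : ℝ, X = uMat a (κ * a) x y)
    (hh : ∀ X, X ∈ 𝔥 ↔ ∃ c : ℝ, X = uMat 0 ((1 + κ) * c) 0 0)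
    (hfund : ∀ a x y p, fund G (uMat a (κ * a) x y) p = fundField κ a x y p)
    (hrot : ∀ B : G, ∃ L c s, IsFrameRotation L c s ∧ ∀ p : H31, ((B • p : H31) : ℂ × ℂ) = L p) :
    IsCanonicalConnection G 𝔥 𝔪 (twist (1 + κ)) where
  invariant B hB V W V' W' hV hW p := by
    obtain ⟨L, c, s, hL, hf⟩ := hrot B
    have hd : ∀ (p : H31) (v : ℂ × ℂ), v ∈ tangent p → hB.deriv p v = L v := fun p v hv =>
      deriv_eq_of_linear (f := fun p => B • p) hf hB p hv
    rw [hd p _ (VField.mem_tangent _ _)]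
    exact hL.twist (f := fun p => B • p) hf
      (fun p => by rw [hV, hd p _ (VField.mem_tangent _ _)])
      (fun p => by rw [hW, hd p _ (VField.mem_tangent _ _)]) _ p
  eval X hX Y hY := by
    obtain ⟨a, x, y, rfl⟩ := (hm X).1 hX
    obtain ⟨a', x', y', rfl⟩ := (hm Y).1 hY
    -- With e = 2(yx' - xy'), the commutator has diagonal (ei, -ei). Its 𝔪-part must have diagonal
    -- (ei, κei), which leaves -(1 + κ)ei in the lower corner for 𝔥.
    refine ⟨_, (hm _).2 ⟨2 * (y * x' - x * y'), (κ - 1) * (a * y' - a' * y),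
      (1 - κ) * (a * x' - a' * x), rfl⟩, (hh _).2 ⟨-(2 * (y * x' - x * y')), ?_⟩,
      fundField κ a x y, fundField κ a' x' y', fun p => (hfund _ _ _ p).symm,
      fun p => (hfund _ _ _ p).symm, by rw [hfund, twist_fundField_o]⟩
    rw [sub_eq_iff_eq_add, uMat_commutator, uMat_add]
    congr 1 <;> ring

/-- Here τ takes the first row of a matrix, and ρ sends diag(0, bi) to b φ₀, because bracketing
diag(0, bi) with 𝔪 multiplies x + yi by -bi. The 𝔪-part of a commutator matches S_X Y - S_Y X
through κ - 1 = (λ - t)/μ; its 𝔥-part matches the curvature through k = 1 + κ. -/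
theorem exists_model (hκ : κ = 1 + (lam - t) / mu)
    (hm : ∀ X, X ∈ 𝔪 ↔ ∃ a x y : ℝ, X = uMat a (κ * a) x y)
    (hh : ∀ X, X ∈ 𝔥 ↔ ∃ c : ℝ, X = uMat 0 ((1 + κ) * c) 0 0) :
    ∃ (τ : 𝔪 ≃ₗ[ℝ] tangent o) (ρ : 𝔥 ≃ₗ[ℝ] hol (twist (1 + κ))),
    (∀ X : 𝔪, (τ X : ℂ × ℂ) = ofMat X) ∧
    (∀ U V : 𝔥, ∃ W : 𝔥, (U * V - V * U : Matrix (Fin 2) (Fin 2) ℂ) = W ∧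
      (ρ W : Module.End ℝ (tangent o)) = ρ U * ρ V - ρ V * ρ U) ∧
    (∀ (U : 𝔥) (X : 𝔪), ∃ Y : 𝔪, (U * X - X * U : Matrix (Fin 2) (Fin 2) ℂ) = Y ∧
      τ Y = (ρ U : Module.End ℝ (tangent o)) (τ X)) ∧
    (∀ X Y : 𝔪, ∃ (W : 𝔥) (Z : 𝔪), (X * Y - Y * X : Matrix (Fin 2) (Fin 2) ℂ) = Z + W ∧
      ∀ V₁ V₂ : VField, V₁.at' o = τ X → V₂.at' o = τ Y →
        τ Z = (homTensor lam mu t V₁ V₂ - homTensor lam mu t V₂ V₁).at' o ∧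
        ∀ V₃ : VField, (ρ W : Module.End ℝ (tangent o)) (V₃.at' o) =
          -(curv (twist (1 + κ)) V₁ V₂ V₃).at' o) := by
  have hτmem : ∀ X : 𝔪, ofMat X ∈ tangent o := fun X => by
    obtain ⟨a, x, y, h⟩ := (hm X).1 X.2
    rw [h, ofMat_uMat, mem_tangent]
    simp [polar, o]
  let τ₀ : 𝔪 →ₗ[ℝ] tangent o :=
    { toFun := fun X => ⟨ofMat X, hτmem X⟩
      map_add' := fun X Y => rfl
      map_smul' := fun r X => rfl }
  have hτ : Function.Bijective τ₀ := by
    constructor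
    · rintro ⟨X, hX⟩ ⟨Y, hY⟩ h
      obtain ⟨a, x, y, rfl⟩ := (hm X).1 hX
      obtain ⟨a', x', y', rfl⟩ := (hm Y).1 hY
      have h' : ofMat (uMat a (κ * a) x y) = ofMat (uMat a' (κ * a') x' y') :=
        congrArg Subtype.val h
      simp [ofMat_uMat, Complex.ext_iff] at h'
      obtain ⟨rfl, rfl, rfl⟩ := h'
      rfl
    · rintro ⟨v, hv⟩
      refine ⟨⟨uMat v.1.im (κ * v.1.im) v.2.re v.2.im, (hm _).2 ⟨_, _, _, rfl⟩⟩, Subtype.ext ?_⟩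
      have hv0 : v.1.re = 0 := by simpa [mem_tangent, polar, o] using hv
      change ofMat (uMat v.1.im (κ * v.1.im) v.2.re v.2.im) = v
      rw [ofMat_uMat]
      refine Prod.ext (Complex.ext ?_ ?_) (Complex.ext ?_ ?_) <;> simp [hv0]
  let ρ₀ : 𝔥 →ₗ[ℝ] hol (twist (1 + κ)) :=
    { toFun := fun U => ⟨((U : Matrix (Fin 2) (Fin 2) ℂ) 1 1).im • phiAt, by
        obtain ⟨c, h⟩ := (hh U).1 U.2
        exact mem_hol_twist.2 ⟨c, by rw [h]; simp [uMat]⟩⟩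
      map_add' := fun U V => Subtype.ext (by simp [add_smul])
      map_smul' := fun r U => Subtype.ext (by simp [mul_smul]) }
  have hρ : Function.Bijective ρ₀ := by
    constructor
    · rintro ⟨U, hU⟩ ⟨V, hV⟩ h
      obtain ⟨c, rfl⟩ := (hh U).1 hU
      obtain ⟨d, rfl⟩ := (hh V).1 hV
      have h' : (uMat 0 ((1 + κ) * c) 0 0 1 1).im • phiAt =
        (uMat 0 ((1 + κ) * d) 0 0 1 1).im • phiAt := congrArg Subtype.val h
      have h2 := smul_phiAt_injective h'
      -- Only the products (1 + κ)c and (1 + κ)d are compared, so injectivity also holds when 1 + κ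
      -- = 0 and both spaces are zero.
      simp only [uMat, Matrix.of_apply, Matrix.cons_val, Complex.mul_I_im,
        Complex.ofReal_re] at h2
      exact Subtype.ext (congrArg (fun b => uMat 0 b 0 0) h2)
    · rintro ⟨L, hL⟩
      obtain ⟨c, rfl⟩ := mem_hol_twist.1 hL
      refine ⟨⟨uMat 0 ((1 + κ) * c) 0 0, (hh _).2 ⟨c, rfl⟩⟩, Subtype.ext ?_⟩
      change (uMat 0 ((1 + κ) * c) 0 0 1 1).im • phiAt = _
      simp [uMat]
  refine ⟨LinearEquiv.ofBijective τ₀ hτ, LinearEquiv.ofBijective ρ₀ hρ, fun X => rfl, ?_, ?_, ?_⟩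
  · rintro ⟨U, hU⟩ ⟨V, hV⟩
    refine ⟨0, ?_, ?_⟩
    · obtain ⟨c, rfl⟩ := (hh U).1 hU
      obtain ⟨d, rfl⟩ := (hh V).1 hV
      change uMat 0 ((1 + κ) * c) 0 0 * uMat 0 ((1 + κ) * d) 0 0 -
        uMat 0 ((1 + κ) * d) 0 0 * uMat 0 ((1 + κ) * c) 0 0 = 0
      rw [uMat_commutator]
      ext i j
      fin_cases i <;> fin_cases j <;> simp [uMat]
    · rw [map_zero]
      change 0 = ((U 1 1).im • phiAt) * ((V 1 1).im • phiAt) -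
        ((V 1 1).im • phiAt) * ((U 1 1).im • phiAt)
      rw [smul_mul_smul_comm, smul_mul_smul_comm, mul_comm (V 1 1).im]
      exact LinearMap.ext fun v => Subtype.ext (sub_self _).symm
  · rintro ⟨U, hU⟩ ⟨X, hX⟩
    obtain ⟨c, rfl⟩ := (hh U).1 hU
    obtain ⟨a, x, y, rfl⟩ := (hm X).1 hX
    refine ⟨⟨uMat 0 (κ * 0) ((1 + κ) * c * y) (-((1 + κ) * c * x)), (hm _).2 ⟨_, _, _, rfl⟩⟩,
      ?_, Subtype.ext ?_⟩
    · change uMat 0 ((1 + κ) * c) 0 0 * uMat a (κ * a) x y -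
        uMat a (κ * a) x y * uMat 0 ((1 + κ) * c) 0 0 = uMat _ _ _ _
      rw [uMat_commutator]
      congr 1 <;> ring
    · change ofMat (uMat _ _ _ _) = (uMat 0 ((1 + κ) * c) 0 0 1 1).im •
        ((0, -(Complex.I * (ofMat (uMat a (κ * a) x y)).2)) : ℂ × ℂ)
      simp only [ofMat_uMat]
      refine Prod.ext (Complex.ext ?_ ?_) (Complex.ext ?_ ?_) <;> simp [uMat]
  · rintro ⟨X, hX⟩ ⟨Y, hY⟩
    obtain ⟨a, x, y, rfl⟩ := (hm X).1 hX
    obtain ⟨a', x', y', rfl⟩ := (hm Y).1 hY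
    refine ⟨⟨uMat 0 ((1 + κ) * (-(2 * (y * x' - x * y')))) 0 0, (hh _).2 ⟨_, rfl⟩⟩,
      ⟨uMat (2 * (y * x' - x * y')) (κ * (2 * (y * x' - x * y'))) ((κ - 1) * (a * y' - a' * y))
        ((1 - κ) * (a * x' - a' * x)), (hm _).2 ⟨_, _, _, rfl⟩⟩, ?_, fun V₁ V₂ h₁ h₂ => ⟨?_, ?_⟩⟩
    · change uMat _ _ _ _ * uMat _ _ _ _ - uMat _ _ _ _ * uMat _ _ _ _ =
        uMat _ _ _ _ + uMat _ _ _ _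
      rw [uMat_commutator, uMat_add]
      congr 1 <;> ring
    · replace h₁ : V₁ o = (a * Complex.I, x + y * Complex.I) := congrArg Subtype.val h₁
      replace h₂ : V₂ o = (a' * Complex.I, x' + y' * Complex.I) := congrArg Subtype.val h₂
      obtain ⟨p0, p1, p2⟩ := coframeAt_o (V₁ o)
      obtain ⟨q0, q1, q2⟩ := coframeAt_o (V₂ o)
      refine Subtype.ext ?_
      change ofMat (uMat _ _ _ _) = (homTensor lam mu t V₁ V₂ - homTensor lam mu t V₂ V₁) o
      have hκ' : κ - 1 = (lam - t) / mu := by rw [hκ, add_sub_cancel_left]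
      rw [ofMat_uMat]
      refine (apply_o_eq ?_ ?_ ?_).symm
      · simp [p1, p2, q1, q2]
        simp [h₁, h₂]
        ring
      · rw [hκ']
        simp [p0, p2, q0, q2]
        simp [h₁, h₂]
        ring
      · rw [← neg_sub κ 1, hκ']
        simp [p0, p1, q0, q1]
        simp [h₁, h₂]
        ring
    · intro V₃
      replace h₁ : V₁ o = (a * Complex.I, x + y * Complex.I) := congrArg Subtype.val h₁
      replace h₂ : V₂ o = (a' * Complex.I, x' + y' * Complex.I) := congrArg Subtype.val h₂
      rw [curv_twist_at_o]
      refine Eq.trans ?_ (neg_smul _ _)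
      change (uMat _ _ _ _ 1 1).im • phiAt (V₃.at' o) = _
      congr 1
      simp [uMat, h₁, h₂]
      ring

end Induced

/-! ### The explicit subspaces, their reductive decompositions and the two induced decompositions.
-/

theorem mem_hIso {X : Matrix (Fin 2) (Fin 2) ℂ} : X ∈ hIso ↔ ∃ b : ℝ, X = uMat 0 b 0 0 := by
  have h : ∀ b : ℝ, b • (!![0, 0; 0, Complex.I] : Matrix (Fin 2) (Fin 2) ℂ) = uMat 0 b 0 0 :=
    fun b => by
      ext i j
      fin_cases i <;> fin_cases j <;> simp [uMat]
  simp only [hIso, Submodule.mem_span_singleton, h, eq_comm]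

theorem mem_mComp {lam mu t : ℝ} {X : Matrix (Fin 2) (Fin 2) ℂ} :
    X ∈ mComp lam mu t ↔ ∃ a x y : ℝ, X = uMat a ((1 + (lam - t) / mu) * a) x y := by
  have h : ∀ a x y : ℝ, a • (!![Complex.I, 0; 0, ((1 + (lam - t) / mu : ℝ) : ℂ) * Complex.I] :
      Matrix (Fin 2) (Fin 2) ℂ) + x • !![0, 1; 1, 0] + y • !![0, Complex.I; -Complex.I, 0] =
        uMat a ((1 + (lam - t) / mu) * a) x y := fun a x y => by
    ext i j
    fin_cases i <;> fin_cases j <;> simp [uMat] <;> ring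
  simp only [mComp, Submodule.mem_span_triple, h, eq_comm]

theorem su11_eq_mComp {mu : ℝ} (hmu : 0 < mu) (lam : ℝ) :
    su11 = mComp lam mu (lam + 2 * mu) := by
  have h : (1 + (lam - (lam + 2 * mu)) / mu : ℝ) = -1 := by
    field_simp
    ring
  rw [su11, mComp, h]
  simp [pauli]

theorem isReductiveDecomposition_U11 (lam mu t : ℝ) :
    IsReductiveDecomposition U11 hIso (mComp lam mu t) where
  lie := by
    ext X
    rw [SetLike.mem_coe, Submodule.mem_sup, mem_lieAlg_U11_iff]
    constructor
    · rintro ⟨U, hU, V, hV, rfl⟩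
      obtain ⟨b, rfl⟩ := mem_hIso.1 hU
      obtain ⟨a, x, y, rfl⟩ := mem_mComp.1 hV
      exact ⟨_, _, _, _, uMat_add _ _ _ _ _ _ _ _⟩
    · rintro ⟨a, b, x, y, rfl⟩
      refine ⟨_, mem_hIso.2 ⟨b - (1 + (lam - t) / mu) * a, rfl⟩, _,
        mem_mComp.2 ⟨a, x, y, rfl⟩, ?_⟩
      rw [uMat_add]
      congr 1 <;> ring
  disjoint := by
    rw [Submodule.disjoint_def]
    intro X hX hX'
    obtain ⟨b, rfl⟩ := mem_hIso.1 hX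
    obtain ⟨a, x, y, h⟩ := mem_mComp.1 hX'
    obtain ⟨ha, hb, -, -⟩ := uMat_injective h
    rw [hb, ← ha]
    ext i j
    fin_cases i <;> fin_cases j <;> simp [uMat]
  isotropy_lie := by
    ext X
    rw [SetLike.mem_coe, mem_hIso, mem_lieAlg_isotropy_U11]
  ad A hA X hX := by
    obtain ⟨a, x, y, rfl⟩ := mem_mComp.1 hX
    obtain ⟨hU, h00, h01, h10⟩ := mem_isotropy_U11.1 hA
    obtain ⟨-, k00, k01, k10⟩ := mem_isotropy_U11.1 (inv_mem hA)
    have hmul : (A : Matrix (Fin 2) (Fin 2) ℂ) *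
        ((A⁻¹ : GL (Fin 2) ℂ) : Matrix (Fin 2) (Fin 2) ℂ) = 1 := by
      rw [← Units.val_mul, mul_inv_cancel, Units.val_one]
    have hJ : (A : Matrix (Fin 2) (Fin 2) ℂ)ᴴ * J * A = J := hU
    have e1 := congrFun (congrFun hmul 1) 1
    have e2 := congrFun (congrFun hJ 1) 1
    generalize ((A⁻¹ : GL (Fin 2) ℂ) : Matrix (Fin 2) (Fin 2) ℂ) = N at *
    generalize (A : Matrix (Fin 2) (Fin 2) ℂ) = M at *
    simp [Matrix.mul_apply, Fin.sum_univ_two, J, h01, h10, k01] at e1 e2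
    -- An isotropy element is diag(1, w) with |w| = 1, so its inverse has lower entry w̄.
    -- Conjugation by it fixes the diagonal and multiplies x + yi by w̄.
    have hconj : starRingEnd ℂ (M 1 1) = N 1 1 := by
      linear_combination N 1 1 * e2 - starRingEnd ℂ (M 1 1) * e1
    have hconj' : starRingEnd ℂ (N 1 1) = M 1 1 := by
      rw [← hconj, Complex.conj_conj]
    refine mem_mComp.2 ⟨a, ((x + y * Complex.I) * N 1 1).re, ((x + y * Complex.I) * N 1 1).im, ?_⟩
    have hz := Complex.re_add_im ((x + y * Complex.I) * N 1 1)
    have hz' := congrArg (starRingEnd ℂ) hz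
    simp only [map_add, map_mul, Complex.conj_ofReal, Complex.conj_I, hconj'] at hz'
    ext i j
    fin_cases i <;> fin_cases j <;>
      simp only [Fin.zero_eta, Fin.mk_one, Matrix.mul_apply, Fin.sum_univ_two, h00, h01, h10, k00,
        k01, k10, uMat, Matrix.of_apply, Matrix.cons_val_zero, Matrix.cons_val_one]
    · ring
    · linear_combination -hz
    · linear_combination -hz'
    · linear_combination (((1 + (lam - t) / mu) * a : ℝ) * Complex.I) * e1

theorem isReductiveDecomposition_SU11 {mu : ℝ} (hmu : 0 < mu) (lam : ℝ) :
    IsReductiveDecomposition SU11 ⊥ (mComp lam mu (lam + 2 * mu)) where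
  lie := by
    have h : (1 + (lam - (lam + 2 * mu)) / mu : ℝ) = -1 := by
      field_simp
      ring
    ext X
    rw [bot_sup_eq, SetLike.mem_coe, mem_lieAlg_SU11_iff, mem_mComp, h]
    simp only [neg_one_mul]
  disjoint := disjoint_bot_left
  isotropy_lie := by
    rw [lieAlg_isotropy_SU11, Submodule.bot_coe]
  ad A hA X hX := by
    rw [mem_isotropy_SU11.1 hA]
    simpa using hX

theorem isInducedDecomposition {lam mu t κ : ℝ} {G : Subgroup (GL (Fin 2) ℂ)} [MulAction G H31]
    {𝔥 𝔪 : Submodule ℝ (Matrix (Fin 2) (Fin 2) ℂ)} (hmu : 0 < mu) (hκ : κ = 1 + (lam - t) / mu)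
    (hred : IsReductiveDecomposition G 𝔥 𝔪)
    (hm : ∀ X, X ∈ 𝔪 ↔ ∃ a x y : ℝ, X = uMat a (κ * a) x y)
    (hh : ∀ X, X ∈ 𝔥 ↔ ∃ c : ℝ, X = uMat 0 ((1 + κ) * c) 0 0)
    (hfund : ∀ a x y p, fund G (uMat a (κ * a) x y) p = fundField κ a x y p)
    (hrot : ∀ B : G, ∃ L c s, IsFrameRotation L c s ∧ ∀ p : H31, ((B • p : H31) : ℂ × ℂ) = L p) :
    IsInducedDecomposition (leviCivita lam mu) (homTensor lam mu t) G 𝔥 𝔪 := by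
  have hcanon : canon (leviCivita lam mu) (homTensor lam mu t) = twist (1 + κ) := by
    rw [canon_leviCivita hmu, hκ]
    congr 1
    field_simp
    ring
  refine ⟨hred, ?_, ?_⟩
  · rw [hcanon]
    exact isCanonicalConnection_twist hm hh hfund hrot
  · rw [hcanon]
    obtain ⟨τ, ρ, h1, h2, h3, h4⟩ := exists_model hκ hm hh
    refine ⟨τ, ρ, fun X => ?_, h2, h3, h4⟩
    obtain ⟨a, x, y, h⟩ := (hm X).1 X.2
    rw [h1, h, hfund, fundField_o, ofMat_uMat]

theorem isInducedDecomposition_U11 {lam mu t : ℝ} (hmu : 0 < mu) (ht : t ≠ lam + 2 * mu) :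
    IsInducedDecomposition (leviCivita lam mu) (homTensor lam mu t) U11 hIso (mComp lam mu t) := by
  -- This is k ≠ 0. It lets every diag(0, bi) be written with b = (1 + κ)c, so that 𝔥 has the same
  -- dimension as the holonomy algebra.
  have hk : 1 + (1 + (lam - t) / mu) ≠ 0 := by
    intro h
    field_simp at h
    exact ht (by linarith)
  refine isInducedDecomposition hmu rfl (isReductiveDecomposition_U11 lam mu t)
    (fun _ => mem_mComp) (fun X => ?_) (fund_U11_uMat _) exists_isFrameRotation_U11
  rw [mem_hIso]
  constructor
  · rintro ⟨b, rfl⟩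
    exact ⟨b / (1 + (1 + (lam - t) / mu)), by rw [mul_div_cancel₀ _ hk]⟩
  · rintro ⟨c, rfl⟩
    exact ⟨_, rfl⟩

theorem isInducedDecomposition_SU11 {lam mu : ℝ} (hmu : 0 < mu) :
    IsInducedDecomposition (leviCivita lam mu) (homTensor lam mu (lam + 2 * mu)) SU11 ⊥ su11 := by
  have h : (-1 : ℝ) = 1 + (lam - (lam + 2 * mu)) / mu := by
    field_simp
    ring
  have hz : uMat 0 0 0 0 = 0 := by
    ext i j
    fin_cases i <;> fin_cases j <;> simp [uMat]
  rw [su11_eq_mComp hmu lam]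
  refine isInducedDecomposition hmu h (isReductiveDecomposition_SU11 hmu lam)
    (fun X => by rw [mem_mComp, ← h]) (fun X => ?_) fund_SU11_uMat exists_isFrameRotation_SU11
  simp [hz]

end AdS

/-! ### The main theorem: uniqueness identifies D and S with the explicit models. -/

theorem mainTheorem8 (lam mu nu t : ℝ) (hlam : lam ≠ 0) (hmu : 0 < mu) (hnu : 0 < nu)
    (hne : -lam ≠ mu) (heq : mu = nu) :
    AdS.IsPseudoRiemannian (AdS.metric lam mu nu) ∧
    (∃! D : AdS.VField → AdS.VField → AdS.VField,
      AdS.IsLeviCivita (AdS.metric lam mu nu) D) ∧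
    (∃! S : AdS.VField →ₗ[AdS.Smooth] AdS.VField →ₗ[AdS.Smooth] AdS.VField,
      ∀ X Y Z, AdS.metric lam mu nu (S X Y) Z = AdS.Slam lam t X Y Z) ∧
    ∀ (D : AdS.VField → AdS.VField → AdS.VField)
      (S : AdS.VField →ₗ[AdS.Smooth] AdS.VField →ₗ[AdS.Smooth] AdS.VField),
      AdS.IsLeviCivita (AdS.metric lam mu nu) D →
      (∀ X Y Z, AdS.metric lam mu nu (S X Y) Z = AdS.Slam lam t X Y Z) →
      AdS.IsHomogeneousAlmostContactMetric (AdS.metric lam mu nu) D S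
        (AdS.phi0 lam mu nu) (AdS.xi0 lam mu nu) (AdS.eta0 lam mu nu) ∧
      AdS.IsSasakian (AdS.metric lam mu nu) D
        (AdS.phi0 lam mu nu) (AdS.xi0 lam mu nu) (AdS.eta0 lam mu nu)
        (algebraMap ℝ AdS.Smooth (√|lam| / mu)) ∧
      (t ≠ lam + 2 * mu →
        AdS.IsTransitiveIsometricAction (AdS.metric lam mu nu) (AdS.SU11 × Circle) ∧
        AdS.IsAlmostEffective (AdS.SU11 × Circle) ∧
        Function.Surjective AdS.psi ∧
        (∀ (x : AdS.SU11 × Circle) (p : AdS.H31), x • p = AdS.psi x • p) ∧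
        AdS.IsTransitiveIsometricAction (AdS.metric lam mu nu) AdS.U11 ∧
        FaithfulSMul AdS.U11 AdS.H31 ∧
        AdS.IsInducedDecomposition D S AdS.U11 AdS.hIso (AdS.mComp lam mu t)) ∧
      (t = lam + 2 * mu →
        AdS.IsTransitiveIsometricAction (AdS.metric lam mu nu) AdS.SU11 ∧
        FaithfulSMul AdS.SU11 AdS.H31 ∧
        AdS.IsInducedDecomposition D S AdS.SU11 ⊥ AdS.su11) := by
  subst heq
  have hg := AdS.isPseudoRiemannian_metric hlam hmu hmu
  have hLC := AdS.isLeviCivita_leviCivita (lam := lam) hmu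
  have hS : ∀ S : AdS.VField →ₗ[AdS.Smooth] AdS.VField →ₗ[AdS.Smooth] AdS.VField,
      (∀ X Y Z, AdS.metric lam mu mu (S X Y) Z = AdS.Slam lam t X Y Z) →
      S = AdS.homTensor lam mu t := fun S h => LinearMap.ext fun X => LinearMap.ext fun Y =>
    hg.ext fun Z => (h X Y Z).trans (AdS.metric_homTensor hmu lam t X Y Z).symm
  refine ⟨hg, ⟨_, hLC, fun D hD => hD.unique hg hLC⟩,
    ⟨_, AdS.metric_homTensor hmu lam t, hS⟩, fun D S hD h => ?_⟩
  obtain rfl := hD.unique hg hLC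
  obtain rfl := hS S h
  refine ⟨AdS.isHomogeneousAlmostContactMetric hlam hmu t, AdS.isSasakian hlam hmu,
    fun ht => ⟨AdS.isTransitiveIsometricAction_prod lam mu, AdS.isAlmostEffective_prod,
      AdS.psi_surjective, AdS.smul_eq_psi_smul, AdS.isTransitiveIsometricAction_U11 lam mu,
      inferInstance, AdS.isInducedDecomposition_U11 hmu ht⟩, ?_⟩
  rintro rfl
  exact ⟨AdS.isTransitiveIsometricAction_SU11 lam mu, inferInstance,
    AdS.isInducedDecomposition_SU11 hmu⟩

end
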